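/- Let $F_n$ be the free group on $x_1,\dots,x_n$, and let $P\Sigma_n^+\le \mathrm{Aut}(F_n)$ be the upper triangular McCool group, i.e. the subgroup generated by the automorphisms $\alpha_{ij}$, $1\le j<i\le n$, where $\alpha_{ij}(x_i)=x_jx_ix_j^{-1}$ and $\alpha_{ij}(x_r)=x_r$ for $r\ne i$. For a group $\pi$ let $\Gamma^1\pi=\pi$, $\Gamma^{p+1}\pi=[\pi,\Gamma^p\pi]$ be the descending central series, and let $gr_*(\pi)=\bigoplus_{p\ge1}\Gamma^p\pi/\Gamma^{p+1}\pi$ be the associated Lie ring over $\mathbb Z$, with bracket induced by the commutator of $\pi$. Let $V_q=\mathbb Z^q$ with standard basis $e_1,\dots,e_q$, let $L[V_q]$ be the free Lie algebra over $\mathbb Z$ on $V_q$, that is, the smallest Lie subalgebra of the tensor algebra $T[V_q]$ that contains $V_q$, and let $L_s[V_q]=L[V_q]\cap V_q^{\otimes s}$. (1) For every $s\ge 2$ there is an isomorphism of abelian groups $$\bigoplus_{q=2}^n L_s[V_{q-1}]\;\cong\;\Gamma^sP\Sigma_n^+/\Gamma^{s+1}P\Sigma_n^+ .$$ (2) For each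 $2\le q\le n$ there is an injective homomorphism of Lie algebras $\varphi_q:L[V_{q-1}]\to gr_*(P\Sigma_n^+)$ that sends $e_j$ to the class of $\alpha_{q,j}$ in degree $1$, for $1\le j\le q-1$; so each $L[V_{q-1}]$ is a Lie subalgebra of $gr_*(P\Sigma_n^+)$. The sum of the $\varphi_q$ is an isomorphism of abelian groups $$\Phi:\bigoplus_{q=2}^n L[V_{q-1}]\;\to\; gr_*(P\Sigma_n^+),$$ which restricts, for each $s\ge1$, to an isomorphism of abelian groups $\bigoplus_{q=2}^n L_s[V_{q-1}]\to\Gamma^sP\Sigma_n^+/\Gamma^{s+1}P\Sigma_n^+$. If $n\ge3$, then $\Phi$ does not preserve brackets, where the direct sum has the componentwise bracket. (3) There is an isomorphism of abelian groups $$\bigoplus_{q=2}^n V_{q-1}\;\cong\;\Gamma^1P\Sigma_n^+/\Gamma^2P\Sigma_n^+,$$ sending the basis vector $e_j$ of $V_{q-1}$ to the class of $\alpha_{q,j}$; and $\Gamma^1P\Sigma_n^+/\Gamma^2P\Sigma_n^+$ is the abelianization $H_1(P\Sigma_n^+)$, by the isomorphism that sends the class of each element to its class. -/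

import Mathlib

open scoped DirectSum

/-! ### The descending central series of a group and its associated graded Lie ring -/

namespace DescendingCentral

open scoped commutatorElement

/-- The descending central series `Γ¹(π) = π`, `Γᵖ⁺¹(π) = [Γᵖ(π), π]`
(with the harmless convention `Γ⁰(π) = π`). -/
def Gam (π : Type*) [Group π] (p : ℕ) : Subgroup π :=
  (⊤ : Subgroup π).lowerCentralSeries (p - 1)

section Series

variable {π : Type*} [Group π]

theorem Gam_one : Gam π 1 = ⊤ := rfl

theorem mem_Gam_one (x : π) : x ∈ Gam π 1 := Subgroup.mem_top x

instance Gam_normal (p : ℕ) : (Gam π p).Normal := by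
  unfold Gam; infer_instance

theorem Gam_antitone : Antitone (Gam π) := fun _ _ h =>
  Subgroup.lowerCentralSeries_antitone _ (Nat.sub_le_sub_right h 1)

theorem Gam_succ_succ (p : ℕ) : Gam π (p + 1 + 1) = ⁅Gam π (p + 1), (⊤ : Subgroup π)⁆ := rfl

theorem comm_top_le (p : ℕ) : ⁅Gam π p, (⊤ : Subgroup π)⁆ ≤ Gam π (p + 1) := by
  cases p with
  | zero => exact le_top
  | succ p => exact le_of_eq (Gam_succ_succ p).symm

/-- The three subgroups lemma relative to a normal subgroup. -/
theorem three_subgroups (H K L N : Subgroup π) [N.Normal]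
    (h1 : ⁅⁅K, L⁆, H⁆ ≤ N) (h2 : ⁅⁅L, H⁆, K⁆ ≤ N) : ⁅⁅H, K⁆, L⁆ ≤ N := by
  have key : ∀ S : Subgroup π, S ≤ N ↔ S.map (QuotientGroup.mk' N) = ⊥ := by
    intro S
    rw [Subgroup.map_eq_bot_iff, QuotientGroup.ker_mk']
  rw [key] at h1 h2 ⊢
  simp only [Subgroup.map_commutator] at h1 h2 ⊢
  exact Subgroup.commutator_commutator_eq_bot_of_rotate h1 h2

theorem comm_le (p q : ℕ) : ⁅Gam π p, Gam π q⁆ ≤ Gam π (p + q) := by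
  induction q generalizing p with
  | zero =>
    exact (Subgroup.commutator_mono (le_refl _) (le_top (a := Gam π 0))).trans
      ((comm_top_le p).trans (Gam_antitone (Nat.le_succ p)))
  | succ q ih =>
    cases q with
    | zero => exact comm_top_le p
    | succ q =>
      rw [Gam_succ_succ q, Subgroup.commutator_comm]
      apply three_subgroups
      · rw [Subgroup.commutator_comm (⊤ : Subgroup π)]
        refine (Subgroup.commutator_mono (comm_top_le p) le_rfl).trans ((ih (p + 1)).trans ?_)
        exact Gam_antitone (by omega)
      · exact (Subgroup.commutator_mono (ih p) le_rfl).trans (comm_top_le _)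

theorem commutator_mem {p q : ℕ} {x y : π} (hx : x ∈ Gam π p) (hy : y ∈ Gam π q) :
    ⁅x, y⁆ ∈ Gam π (p + q) :=
  comm_le p q (Subgroup.commutator_mem_commutator hx hy)

end Series

/-- The quotient `Γᵖ(π) / Γᵖ⁺¹(π)`, written multiplicatively. -/
abbrev GrMul (π : Type*) [Group π] (p : ℕ) : Type _ :=
  Gam π p ⧸ (Gam π (p + 1)).subgroupOf (Gam π p)

section GrMul

variable {π : Type*} [Group π]

theorem mk_eq_mk {p : ℕ} (x y : Gam π p) :
    (QuotientGroup.mk x : GrMul π p) = QuotientGroup.mk y ↔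
      QuotientGroup.mk' (Gam π (p + 1)) x = QuotientGroup.mk' (Gam π (p + 1)) y := by
  simp only [QuotientGroup.mk'_apply, QuotientGroup.eq, Subgroup.mem_subgroupOf]
  rfl

theorem quot_comm {p k : ℕ} {x y : π} (hx : x ∈ Gam π p) (hy : y ∈ Gam π k) {N : ℕ}
    (h : N ≤ p + k) :
    Commute (QuotientGroup.mk' (Gam π N) x) (QuotientGroup.mk' (Gam π N) y) := by
  rw [← commutatorElement_eq_one_iff_commute, ← map_commutatorElement, QuotientGroup.mk'_apply,
    QuotientGroup.eq_one_iff]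
  exact Gam_antitone h (commutator_mem hx hy)

theorem quot_comm' {p : ℕ} {x : π} (hx : x ∈ Gam π p) (z : π ⧸ Gam π (p + 1)) :
    Commute (QuotientGroup.mk' (Gam π (p + 1)) x) z := by
  obtain ⟨z, rfl⟩ := QuotientGroup.mk'_surjective _ z
  exact quot_comm hx (mem_Gam_one z) le_rfl

instance grMulCommGroup (p : ℕ) : CommGroup (GrMul π p) :=
  { (inferInstance : Group (GrMul π p)) with
    mul_comm := by
      rintro ⟨x⟩ ⟨y⟩
      refine (mk_eq_mk (x * y) (y * x)).2 ?_
      simpa using (quot_comm' x.2 (QuotientGroup.mk' (Gam π (p + 1)) (y : π))).eq }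

/-- The commutator of elements of `Γᵖ` and `Γ^q`, as an element of `Γ^(p+q)`. -/
def comm {p q : ℕ} (x : Gam π p) (y : Gam π q) : Gam π (p + q) :=
  ⟨⁅(x : π), (y : π)⁆, commutator_mem x.2 y.2⟩

theorem comm_mul_right {p q : ℕ} (x : Gam π p) (y z : Gam π q) :
    (QuotientGroup.mk (comm x (y * z)) : GrMul π (p + q)) =
      QuotientGroup.mk (comm x y) * QuotientGroup.mk (comm x z) := by
  rw [← QuotientGroup.mk_mul, mk_eq_mk]
  have hc := quot_comm' (comm x z).2 (QuotientGroup.mk' (Gam π (p + q + 1)) (y : π))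
  simp only [comm, Subgroup.coe_mul, map_mul, map_commutatorElement] at hc ⊢
  rw [commutatorElement_mul_right_eq_mul_conj, mul_assoc, mul_assoc, ← mul_assoc _ _ (_⁻¹),
    hc.symm.eq]
  group

theorem comm_mul_left {p q : ℕ} (x y : Gam π p) (z : Gam π q) :
    (QuotientGroup.mk (comm (x * y) z) : GrMul π (p + q)) =
      QuotientGroup.mk (comm x z) * QuotientGroup.mk (comm y z) := by
  rw [← QuotientGroup.mk_mul, mk_eq_mk]
  have hc := quot_comm' (comm y z).2 (QuotientGroup.mk' (Gam π (p + q + 1)) (x : π))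
  have hd := quot_comm' (comm y z).2
    ⁅QuotientGroup.mk' (Gam π (p + q + 1)) (x : π), QuotientGroup.mk' (Gam π (p + q + 1)) (z : π)⁆
  simp only [comm, Subgroup.coe_mul, map_mul, map_commutatorElement] at hc hd ⊢
  rw [commutatorElement_mul_left_eq_conj_mul, hc.symm.eq, mul_inv_cancel_right, hd.eq]

/-- For fixed `x ∈ Γᵖ`, the homomorphism `Γ^q/Γ^(q+1) → Γ^(p+q)/Γ^(p+q+1)`, `y ↦ [x, y]`. -/
def brRight {p : ℕ} (q : ℕ) (x : Gam π p) : GrMul π q →* GrMul π (p + q) :=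
  QuotientGroup.lift _
    (MonoidHom.mk' (fun y : Gam π q => (QuotientGroup.mk (comm x y) : GrMul π (p + q)))
      (comm_mul_right x))
    (by
      intro y hy
      rw [Subgroup.mem_subgroupOf] at hy
      refine (QuotientGroup.eq_one_iff _).2 ?_
      rw [Subgroup.mem_subgroupOf]
      exact commutator_mem (q := q + 1) x.2 hy)

/-- The commutator pairing on the quotients of the descending central series. -/
def br (p q : ℕ) : GrMul π p →* GrMul π q →* GrMul π (p + q) :=
  QuotientGroup.lift _
    (MonoidHom.mk' (fun x : Gam π p => brRight q x) (by
      intro x y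
      ext z
      exact comm_mul_left x y z))
    (by
      intro x hx
      rw [Subgroup.mem_subgroupOf] at hx
      ext z
      refine (QuotientGroup.eq_one_iff _).2 ?_
      rw [Subgroup.mem_subgroupOf]
      exact Gam_antitone (by omega) (commutator_mem hx z.2))

end GrMul

/-- The abelian group `gr_p(π) = Γᵖ(π) / Γᵖ⁺¹(π)`, written additively. -/
abbrev GrPiece (π : Type*) [Group π] (p : ℕ) : Type _ := Additive (GrMul π p)

/-- The class in `gr_p(π)` of an element of `Γᵖ(π)`. -/
def cls {π : Type*} [Group π] {p : ℕ} (x : Gam π p) : GrPiece π p :=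
  Additive.ofMul (QuotientGroup.mk x)

/-- The bracket `gr_p(π) × gr_q(π) → gr_{p+q}(π)` as a biadditive map. -/
def brAdd {π : Type*} [Group π] (p q : ℕ) : GrPiece π p →+ GrPiece π q →+ GrPiece π (p + q) :=
  AddMonoidHom.mk' (fun x => (br p q x.toMul).toAdditive) (by
    intro x y
    ext z
    change Additive.ofMul (br p q (x.toMul * y.toMul) z) = _
    rw [map_mul]
    rfl)

theorem brAdd_cls {π : Type*} [Group π] {p q : ℕ} (x : Gam π p) (y : Gam π q) :
    brAdd p q (cls x) (cls y) = cls (comm x y) := rfl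

/-- The bracket is also induced by the commutator `x⁻¹ y⁻¹ x y`. -/
theorem brAdd_cls' {π : Type*} [Group π] {p q : ℕ} (x : Gam π p) (y : Gam π q)
    (h : (x : π)⁻¹ * (y : π)⁻¹ * x * y ∈ Gam π (p + q)) :
    brAdd p q (cls x) (cls y) = cls ⟨(x : π)⁻¹ * (y : π)⁻¹ * x * y, h⟩ := by
  have h1 : brAdd p q (cls x⁻¹) (cls y⁻¹) = brAdd p q (cls x) (cls y) := by
    change brAdd p q (-cls x) (-cls y) = _
    rw [map_neg, map_neg, AddMonoidHom.neg_apply, neg_neg]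
  rw [← h1, brAdd_cls]
  congr 1
  ext
  simp [comm, commutatorElement_def]

/-- The bracket in degrees `p, q ≥ 1`. -/
def brPos {π : Type*} [Group π] (p q : ℕ+) :
    GrPiece π p →+ GrPiece π q →+ GrPiece π ((p + q : ℕ+) : ℕ) :=
  brAdd (p : ℕ) (q : ℕ)

/-- The associated graded `gr_*(π) = ⨁_{p ≥ 1} Γᵖ(π) / Γᵖ⁺¹(π)`. -/
def Gr (π : Type*) [Group π] : Type _ := ⨁ p : ℕ+, GrPiece π p

namespace Gr

variable {π : Type*} [Group π]

noncomputable instance : AddCommGroup (Gr π) :=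
  inferInstanceAs (AddCommGroup (⨁ p : ℕ+, GrPiece π p))

/-- The inclusion of the degree `p` part. -/
noncomputable def of (p : ℕ+) : GrPiece π p →+ Gr π :=
  DirectSum.of (fun p : ℕ+ => GrPiece π p) p

/-- The bracket of homogeneous elements, with values in `gr_*(π)` and arguments exchanged. -/
noncomputable def bracketFlip (p q : ℕ+) : GrPiece π q →+ GrPiece π p →+ Gr π :=
  AddMonoidHom.flip ((AddMonoidHom.compHom (of (p + q))).comp (brPos p q))

/-- The bracket of a homogeneous element with an arbitrary one. -/
noncomputable def bracketLeft (p : ℕ+) : GrPiece π p →+ Gr π →+ Gr π :=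
  AddMonoidHom.flip (DirectSum.toAddMonoid (bracketFlip p))

/-- The biadditive extension of the brackets of homogeneous elements. -/
noncomputable def bracketHom : Gr π →+ Gr π →+ Gr π :=
  DirectSum.toAddMonoid bracketLeft

noncomputable instance : Bracket (Gr π) (Gr π) := ⟨fun x y => bracketHom x y⟩

theorem bracket_of_of (p q : ℕ+) (x : GrPiece π p) (y : GrPiece π q) :
    ⁅of p x, of q y⁆ = of (p + q) (brPos p q x y) := by
  have h1 : bracketHom (of p x) = bracketLeft p x := DirectSum.toAddMonoid_of _ _ _
  have h2 : DirectSum.toAddMonoid (bracketFlip p) (of q y) = bracketFlip p q y :=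
    DirectSum.toAddMonoid_of _ _ _
  exact (DFunLike.congr_fun h1 _).trans (DFunLike.congr_fun h2 x)

theorem add_bracket (x y z : Gr π) : ⁅x + y, z⁆ = ⁅x, z⁆ + ⁅y, z⁆ := by
  change bracketHom _ _ = _
  rw [map_add]; rfl

theorem bracket_add (x y z : Gr π) : ⁅x, y + z⁆ = ⁅x, y⁆ + ⁅x, z⁆ := by
  change bracketHom _ _ = _
  rw [map_add]; rfl

theorem zero_bracket (x : Gr π) : ⁅(0 : Gr π), x⁆ = 0 := by
  change bracketHom _ _ = _
  rw [map_zero]; rfl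

theorem bracket_zero (x : Gr π) : ⁅x, (0 : Gr π)⁆ = 0 := by
  change bracketHom _ _ = _
  rw [map_zero]

/-- The homogeneous element of degree `p` represented by `x ∈ Γᵖ(π)`. -/
noncomputable def elt (p : ℕ+) (x : π) (hx : x ∈ Gam π p) : Gr π := of p (cls ⟨x, hx⟩)

theorem induction {C : Gr π → Prop} (h0 : C 0)
    (h1 : ∀ (p : ℕ+) (x : π) (hx : x ∈ Gam π p), C (elt p x hx))
    (h2 : ∀ x y, C x → C y → C (x + y)) (x : Gr π) : C x := by
  refine DirectSum.induction_on (motive := C) x h0 ?_ h2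
  intro p a
  obtain ⟨a, rfl⟩ := QuotientGroup.mk_surjective a
  exact h1 p a a.2

theorem commutator_mem_pos {p q : ℕ+} {x y : π} (hx : x ∈ Gam π p) (hy : y ∈ Gam π q) :
    ⁅x, y⁆ ∈ Gam π ((p + q : ℕ+) : ℕ) :=
  commutator_mem hx hy

theorem bracket_elt {p q : ℕ+} {x y : π} (hx : x ∈ Gam π p) (hy : y ∈ Gam π q) :
    ⁅elt p x hx, elt q y hy⁆ = elt (p + q) ⁅x, y⁆ (commutator_mem_pos hx hy) :=
  bracket_of_of p q _ _

theorem elt_congr {p q : ℕ+} (h : p = q) {x y : π} (hx : x ∈ Gam π p) (hy : y ∈ Gam π q)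
    (hxy : QuotientGroup.mk' (Gam π (p + 1)) x = QuotientGroup.mk' (Gam π (p + 1)) y) :
    elt p x hx = elt q y hy := by
  subst h
  exact congrArg (of p) (congrArg Additive.ofMul ((mk_eq_mk ⟨x, hx⟩ ⟨y, hy⟩).2 hxy))

theorem neg_elt {p : ℕ+} {x : π} (hx : x ∈ Gam π p) :
    -elt p x hx = elt p x⁻¹ (inv_mem hx) :=
  (map_neg (of p) (cls ⟨x, hx⟩)).symm

theorem elt_add {p : ℕ+} {x y : π} (hx : x ∈ Gam π p) (hy : y ∈ Gam π p) :
    elt p x hx + elt p y hy = elt p (x * y) (mul_mem hx hy) :=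
  (map_add (of p) (cls ⟨x, hx⟩) (cls ⟨y, hy⟩)).symm

theorem elt_one (p : ℕ+) : elt p (1 : π) (one_mem _) = 0 := map_zero (of p)

theorem skew (x y : Gr π) : ⁅x, y⁆ + ⁅y, x⁆ = 0 := by
  induction x using induction with
  | h0 => rw [zero_bracket, bracket_zero, add_zero]
  | h2 a b ha hb =>
    rw [add_bracket, bracket_add, add_add_add_comm, ha, hb, add_zero]
  | h1 p x hx =>
    induction y using induction with
    | h0 => rw [zero_bracket, bracket_zero, add_zero]
    | h2 a b ha hb =>
      rw [add_bracket, bracket_add, add_add_add_comm, ha, hb, add_zero]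
    | h1 q y hy =>
      rw [bracket_elt, bracket_elt, add_eq_zero_iff_eq_neg, neg_elt]
      exact elt_congr (add_comm p q) _ _ (by rw [commutatorElement_inv])

theorem bracket_self (x : Gr π) : ⁅x, x⁆ = 0 := by
  induction x using induction with
  | h0 => rw [zero_bracket]
  | h2 a b ha hb =>
    rw [add_bracket, bracket_add, bracket_add, ha, hb, zero_add, add_zero, skew]
  | h1 p x hx =>
    rw [bracket_elt, ← elt_one (p + p)]
    exact elt_congr rfl _ _ (by rw [commutatorElement_self])

/-- A consequence of the Hall-Witt identity, for elements whose commutators commute suitably. -/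
theorem hall_witt_aux {G : Type*} [Group G] (x y z : G)
    (h1 : ∀ g, Commute ⁅⁅x, y⁆, z⁆ g) (h2 : ∀ g, Commute ⁅y, ⁅x, z⁆⁆ g)
    (h3 : Commute ⁅x, y⁆ ⁅y, z⁆) (h4 : Commute ⁅x, z⁆ ⁅y, z⁆)
    (h5 : Commute ⁅x, y⁆ ⁅x, z⁆) :
    ⁅x, ⁅y, z⁆⁆ = ⁅⁅x, y⁆, z⁆ * ⁅y, ⁅x, z⁆⁆ := by
  have e1 : ⁅x, ⁅y, z⁆⁆ * ⁅y, z⁆ = ⁅⁅x, y⁆ * y, ⁅x, z⁆ * z⁆ := by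
    simp only [commutatorElement_def]; group
  have e2 : ⁅⁅x, y⁆, ⁅x, z⁆ * z⁆ = ⁅⁅x, y⁆, z⁆ := by
    rw [commutatorElement_mul_right_eq_mul_conj, h5.commutator_eq, one_mul,
      (h1 ⁅x, z⁆).symm.eq, mul_inv_cancel_right]
  have e3 : ⁅y, ⁅x, z⁆ * z⁆ = ⁅y, ⁅x, z⁆⁆ * ⁅y, z⁆ := by
    rw [commutatorElement_mul_right_eq_mul_conj, mul_assoc, mul_assoc, ← mul_assoc _ _ (_⁻¹),
      h4.eq, mul_inv_cancel_right]
  rw [commutatorElement_mul_left_eq_conj_mul, e2, e3] at e1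
  apply mul_right_cancel (b := ⁅y, z⁆)
  rw [e1, ((h2 ⁅x, y⁆).symm.mul_right h3).eq, mul_inv_cancel_right, (h1 _).symm.eq, mul_assoc]

theorem leibniz (x y z : Gr π) : ⁅x, ⁅y, z⁆⁆ = ⁅⁅x, y⁆, z⁆ + ⁅y, ⁅x, z⁆⁆ := by
  induction x using induction with
  | h0 => simp only [zero_bracket, bracket_zero, add_zero]
  | h2 a b ha hb =>
    simp only [add_bracket, bracket_add, ha, hb]; abel
  | h1 p x hx =>
    induction y using induction with
    | h0 => simp only [zero_bracket, bracket_zero, add_zero]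
    | h2 a b ha hb =>
      simp only [add_bracket, bracket_add, ha, hb]; abel
    | h1 q y hy =>
      induction z using induction with
      | h0 => simp only [bracket_zero, add_zero]
      | h2 a b ha hb =>
        simp only [bracket_add, ha, hb]; abel
      | h1 r z hz =>
        have hxy := commutator_mem_pos hx hy
        have hxz := commutator_mem_pos hx hz
        have hyz := commutator_mem_pos hy hz
        have hp := p.pos
        have hq := q.pos
        have hr := r.pos
        have hmem : ⁅y, ⁅x, z⁆⁆ ∈ Gam π ((p + q + r : ℕ+) : ℕ) :=
          Gam_antitone (by simp only [PNat.add_coe]; omega) (commutator_mem_pos hy hxz)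
        simp only [bracket_elt]
        rw [elt_congr (show q + (p + r) = p + q + r by rw [← add_assoc, add_comm q p]) _ hmem rfl,
          elt_add]
        refine elt_congr (add_assoc p q r).symm _ _ ?_
        rw [map_mul]
        simp only [map_commutatorElement]
        refine hall_witt_aux _ _ _ ?_ ?_ ?_ ?_ ?_ <;>
          simp only [← map_commutatorElement]
        · intro g
          obtain ⟨g, rfl⟩ := QuotientGroup.mk'_surjective _ g
          exact quot_comm (commutator_mem_pos hxy hz) (mem_Gam_one g) (by simp only [PNat.add_coe]; omega)
        · intro g
          obtain ⟨g, rfl⟩ := QuotientGroup.mk'_surjective _ g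
          exact quot_comm (commutator_mem_pos hy hxz) (mem_Gam_one g) (by simp only [PNat.add_coe]; omega)
        · exact quot_comm hxy hyz (by simp only [PNat.add_coe]; omega)
        · exact quot_comm hxz hyz (by simp only [PNat.add_coe]; omega)
        · exact quot_comm hxy hxz (by simp only [PNat.add_coe]; omega)

/-- The Lie ring structure on `gr_*(π)`, whose bracket is induced by the commutator in `π`. -/
noncomputable instance : LieRing (Gr π) where
  add_lie := add_bracket
  lie_add := bracket_add
  lie_self := bracket_self
  leibniz_lie := leibniz

end Gr

end DescendingCentral

/-! ### Free Lie algebras over the integers -/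

namespace FreeLie

attribute [local instance] LieRing.ofAssociativeRing

/-- The Lie algebra `L[V]` of an abelian group `V`: the smallest Lie subalgebra of the tensor
algebra `T[V]` that contains `V`. -/
noncomputable def freeLie (V : Type*) [AddCommGroup V] : LieSubalgebra ℤ (TensorAlgebra ℤ V) :=
  LieSubalgebra.lieSpan ℤ (TensorAlgebra ℤ V) (Set.range (TensorAlgebra.ι ℤ))

/-- The inclusion of `V` in `L[V]`. -/
noncomputable def inj {V : Type*} [AddCommGroup V] (v : V) : freeLie V :=
  ⟨TensorAlgebra.ι ℤ v, LieSubalgebra.subset_lieSpan ⟨v, rfl⟩⟩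

/-- The degree `s` part `L_s[V] = L[V] ∩ V^{⊗ s}`. -/
noncomputable def freeLiePart (V : Type*) [AddCommGroup V] (s : ℕ) : Submodule ℤ (freeLie V) :=
  ((LinearMap.range (TensorAlgebra.ι ℤ : V →ₗ[ℤ] TensorAlgebra ℤ V)) ^ s).comap
    (freeLie V).toSubmodule.subtype

end FreeLie

/-- The free abelian group `V_q` of rank `q`. -/
abbrev FreeAb (q : ℕ) : Type := Fin q → ℤ

/-! ### The upper triangular McCool group -/

namespace McCool

/-- The endomorphism of the free group `F_n` that sends `x_i` to `w x_i w⁻¹` and fixes the other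
generators. -/
def conjEnd {n : ℕ} (i : Fin n) (w : FreeGroup (Fin n)) :
    FreeGroup (Fin n) →* FreeGroup (Fin n) :=
  FreeGroup.lift (Function.update FreeGroup.of i (w * FreeGroup.of i * w⁻¹))

theorem conjEnd_self {n : ℕ} (i : Fin n) (w : FreeGroup (Fin n)) :
    conjEnd i w (FreeGroup.of i) = w * FreeGroup.of i * w⁻¹ := by
  simp [conjEnd]

theorem conjEnd_ne {n : ℕ} {i r : Fin n} (h : r ≠ i) (w : FreeGroup (Fin n)) :
    conjEnd i w (FreeGroup.of r) = FreeGroup.of r := by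
  simp [conjEnd, h]

/-- The automorphism `α_{ij}` of `F_n`, which sends `x_i` to `x_j x_i x_j⁻¹` and fixes the other
generators (it is the identity for `i = j`). -/
def alpha {n : ℕ} (i j : Fin n) : MulAut (FreeGroup (Fin n)) :=
  MonoidHom.toMulEquiv (conjEnd i (FreeGroup.of j)) (conjEnd i (FreeGroup.of j)⁻¹)
    (by
      ext r
      by_cases hr : r = i
      · subst hr
        by_cases hj : j = r
        · subst hj; simp [conjEnd_self]
        · simp [conjEnd_self, conjEnd_ne hj]; group
      · simp [conjEnd_ne hr])
    (by
      ext r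
      by_cases hr : r = i
      · subst hr
        by_cases hj : j = r
        · subst hj; simp [conjEnd_self]
        · simp [conjEnd_self, conjEnd_ne hj]; group
      · simp [conjEnd_ne hr])

/-- The upper triangular McCool group `PΣ_n⁺`: the subgroup of `Aut(F_n)` generated by the
`α_{ij}` with `j < i`. -/
def PSigmaPlus (n : ℕ) : Subgroup (MulAut (FreeGroup (Fin n))) :=
  Subgroup.closure {a | ∃ i j : Fin n, j < i ∧ a = alpha i j}

/-- The index set `{2, …, n}` of the direct sums. -/
abbrev Idx (n : ℕ) : Type := Finset.Icc 2 n

/-- The generator `α_{q,j+1}` of `PΣ_n⁺` for `2 ≤ q ≤ n` and `0 ≤ j < q - 1`. The generators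
`x_1, …, x_n` are indexed by `Fin n`, so that `x_q` has index `q - 1`. -/
def gen {n : ℕ} (q : Idx n) (j : Fin (q - 1)) : PSigmaPlus n :=
  have hq := Finset.mem_Icc.1 q.2
  ⟨alpha ⟨q - 1, by omega⟩ ⟨j, by omega⟩,
    Subgroup.subset_closure ⟨⟨q - 1, by omega⟩, ⟨j, by omega⟩, j.2, rfl⟩⟩

/-- The class in `gr_1(π) = Γ¹(π)/Γ²(π)` of an element of `π`. -/
def cls₁ {π : Type*} [Group π] (x : π) : DescendingCentral.GrPiece π 1 :=
  DescendingCentral.cls ⟨x, DescendingCentral.mem_Gam_one x⟩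

end McCool

/-! For fixed `q`, the classes of the `α_{q,j}` define a Lie map `genLie q` from the free Lie
algebra on `q - 1` letters to `gr_*`. The theorem says that the sum `genSum` of these maps is
bijective in each degree.

Surjectivity: `gr_*` is generated by degree 1 (`eq_top_of_lie_mem`). McCool's relations show that,
for `p < q`, bracketing with the image of `genLie p` preserves the image of `genLie q`
(`lie_mem_range`). The sum of the images is thus a Lie subring containing the generators.

Injectivity: the Magnus expansion represents `Aut(F_n)` by power series of endomorphisms of the free
associative algebra, and leading coefficients turn `gr_*` into derivations (`johnson`). An element
of the `q`-th summand becomes a derivation `x_q ↦ [W, x_q]` killing the other letters, where `W` is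
the reversed Lie element. Evaluation at `x_q` isolates the `q`-th summand (`johnson_genSum`), and
`[W, x_q] = 0` forces `W = 0` (`eq_zero_of_commute`).

Recovering a Lie element from its associative image needs the free Lie algebra to embed in the free
associative algebra (`toFreeAlgebra_injective`), proved by Lazard elimination. The same fact
identifies `L[V_m]` with a free Lie algebra (`equivFreeLie`). As the isomorphism respects degrees on
generators, it restricts to each degree. It cannot preserve brackets: distinct summands commute in
the direct sum, but the classes of `α_{21}` and `α_{32}` do not commute in `gr_*`. -/

/-! ### The free Lie algebra embeds in the free associative algebra -/

namespace FreeLieEmbedding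

attribute [local instance] LieRing.ofAssociativeRing

variable {R : Type*} [CommRing R]

/-- The canonical map from the free Lie algebra to the free associative algebra. -/
noncomputable def toFreeAlgebra (R : Type*) [CommRing R] (X : Type*) :
    FreeLieAlgebra R X →ₗ⁅R⁆ FreeAlgebra R X :=
  FreeLieAlgebra.lift R (FreeAlgebra.ι R)

@[simp]
theorem toFreeAlgebra_of {X : Type*} (x : X) :
    toFreeAlgebra R X (FreeLieAlgebra.of R x) = FreeAlgebra.ι R x :=
  FreeLieAlgebra.lift_of_apply _ _

/-- `Fil S n z` means that `z` is a linear combination of brackets of at most `n` letters, all of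
them in `S`. -/
inductive Fil {X : Type*} (S : Finset X) : ℕ → FreeLieAlgebra R X → Prop
  | zero (n : ℕ) : Fil S n 0
  | add {n : ℕ} {a b : FreeLieAlgebra R X} : Fil S n a → Fil S n b → Fil S n (a + b)
  | smul {n : ℕ} (c : R) {a : FreeLieAlgebra R X} : Fil S n a → Fil S n (c • a)
  | of {x : X} : x ∈ S → Fil S 1 (FreeLieAlgebra.of R x)
  | mono {m n : ℕ} {a : FreeLieAlgebra R X} : Fil S m a → m ≤ n → Fil S n a
  | lie {m n : ℕ} {a b : FreeLieAlgebra R X} : Fil S m a → Fil S n b → Fil S (m + n) ⁅a, b⁆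

variable {X : Type*}

theorem Fil.mono_set {S S' : Finset X} (h : S ⊆ S') {n : ℕ} {a : FreeLieAlgebra R X}
    (ha : Fil S n a) : Fil S' n a := by
  induction ha with
  | zero n => exact .zero n
  | add _ _ h1 h2 => exact h1.add h2
  | smul c _ h1 => exact h1.smul c
  | of hx => exact .of (h hx)
  | mono _ hmn h1 => exact h1.mono hmn
  | lie _ _ h1 h2 => exact h1.lie h2

theorem Fil.eq_zero_of_length {S : Finset X} {n : ℕ} {a : FreeLieAlgebra R X}
    (ha : Fil S n a) (hn : n = 0) : a = 0 := by
  induction ha with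
  | zero n => rfl
  | add _ _ h1 h2 => rw [h1 hn, h2 hn, add_zero]
  | smul c _ h1 => rw [h1 hn, smul_zero]
  | of hx => exact absurd hn one_ne_zero
  | mono _ hmn h1 => exact h1 (by omega)
  | lie _ _ h1 h2 => rw [h1 (by omega), zero_lie]

theorem Fil.eq_zero_of_letters {S : Finset X} {n : ℕ} {a : FreeLieAlgebra R X}
    (ha : Fil S n a) (hS : S = ∅) : a = 0 := by
  induction ha with
  | zero n => rfl
  | add _ _ h1 h2 => rw [h1, h2, add_zero]
  | smul c _ h1 => rw [h1, smul_zero]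
  | of hx => simp [hS] at hx
  | mono _ _ h1 => exact h1
  | lie _ _ h1 h2 => rw [h1, zero_lie]

/-- The free Lie algebra is exhausted by the subsets `Fil S n`. -/
theorem exists_fil [DecidableEq X] (z : FreeLieAlgebra R X) : ∃ S n, Fil S n z := by
  let A : LieSubalgebra R (FreeLieAlgebra R X) :=
    { carrier := {z | ∃ S n, Fil S n z}
      zero_mem' := ⟨∅, 0, .zero 0⟩
      add_mem' := by
        rintro a b ⟨S, n, ha⟩ ⟨S', n', hb⟩
        exact ⟨S ∪ S', n + n', ((ha.mono_set Finset.subset_union_left).mono (by omega)).add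
          ((hb.mono_set Finset.subset_union_right).mono (by omega))⟩
      smul_mem' := by
        rintro c a ⟨S, n, ha⟩
        exact ⟨S, n, ha.smul c⟩
      lie_mem' := by
        rintro a b ⟨S, n, ha⟩ ⟨S', n', hb⟩
        exact ⟨S ∪ S', n + n', (ha.mono_set Finset.subset_union_left).lie
          (hb.mono_set Finset.subset_union_right)⟩ }
  let f : FreeLieAlgebra R X →ₗ⁅R⁆ A :=
    FreeLieAlgebra.lift R fun x => ⟨FreeLieAlgebra.of R x, {x}, 1, .of (Finset.mem_singleton_self x)⟩
  have hf : A.incl.comp f = LieHom.id := by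
    ext x
    simp [f]
  have := congrArg (fun g => g z) hf
  simp only [LieHom.comp_apply, LieHom.id_apply] at this
  rw [← this]
  exact (f z).2

/-! ### Derivations of a free associative algebra. -/

section Derivation

variable {Y : Type*}

/-- Algebra homomorphism to the dual numbers whose second component is the derivation
`y ↦ f y`. -/
noncomputable def dualHom (f : Y → FreeAlgebra R Y) :
    FreeAlgebra R Y →ₐ[R] TrivSqZeroExt (FreeAlgebra R Y) (FreeAlgebra R Y) :=
  FreeAlgebra.lift R fun y => TrivSqZeroExt.inl (FreeAlgebra.ι R y) + TrivSqZeroExt.inr (f y)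

theorem dualHom_fst (f : Y → FreeAlgebra R Y) (a : FreeAlgebra R Y) :
    (dualHom f a).fst = a := by
  have : (TrivSqZeroExt.fstHom R (FreeAlgebra R Y) (FreeAlgebra R Y)).comp (dualHom f) =
      AlgHom.id R _ := by
    ext y
    simp [dualHom]
  exact DFunLike.congr_fun this a

/-- The derivation of the free algebra with prescribed values on the generators. -/
noncomputable def freeDerivation (f : Y → FreeAlgebra R Y) : Module.End R (FreeAlgebra R Y) :=
  (TrivSqZeroExt.sndHom (R := FreeAlgebra R Y) (M := FreeAlgebra R Y)).restrictScalars R ∘ₗ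
    (dualHom f).toLinearMap

theorem freeDerivation_mul (f : Y → FreeAlgebra R Y) (a b : FreeAlgebra R Y) :
    freeDerivation f (a * b) = freeDerivation f a * b + a * freeDerivation f b := by
  simp [freeDerivation, dualHom_fst, add_comm]

@[simp]
theorem freeDerivation_ι (f : Y → FreeAlgebra R Y) (y : Y) :
    freeDerivation f (FreeAlgebra.ι R y) = f y := by
  simp [freeDerivation, dualHom]

end Derivation

/-! ### Lazard elimination of one letter. -/

section Elimination

variable (R) (x : X)

/-- The letters of the elimination of `x`: `(y, k)` stands for `(ad x)^k y`. -/
abbrev ElimLetter (x : X) : Type _ := {y : X // y ≠ x} × ℕ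

/-- The elements `(ad x)^k y`. -/
noncomputable def adPow : ElimLetter x → FreeLieAlgebra R X := fun p =>
  ((LieAlgebra.ad R _ (FreeLieAlgebra.of R x)) ^ p.2) (FreeLieAlgebra.of R p.1.1)

theorem adPow_succ (y : {y : X // y ≠ x}) (k : ℕ) :
    adPow R x (y, k + 1) = ⁅FreeLieAlgebra.of R x, adPow R x (y, k)⁆ := by
  simp only [adPow, pow_succ', Module.End.mul_apply, LieAlgebra.ad_apply]

/-- The substitution `(y, k) ↦ (ad x)^k y` of free Lie algebras. -/
noncomputable def elimLie : FreeLieAlgebra R (ElimLetter x) →ₗ⁅R⁆ FreeLieAlgebra R X :=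
  FreeLieAlgebra.lift R (adPow R x)

/-- The substitution `(y, k) ↦ (ad x)^k y` of free associative algebras. -/
noncomputable def elimAlg : FreeAlgebra R (ElimLetter x) →ₐ[R] FreeAlgebra R X :=
  FreeAlgebra.lift R fun p => toFreeAlgebra R X (adPow R x p)

theorem toFreeAlgebra_elimLie (u : FreeLieAlgebra R (ElimLetter x)) :
    toFreeAlgebra R X (elimLie R x u) = elimAlg R x (toFreeAlgebra R _ u) := by
  have : (toFreeAlgebra R X).comp (elimLie R x) =
      ((elimAlg R x : FreeAlgebra R (ElimLetter x) →ₗ⁅R⁆ FreeAlgebra R X)).comp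
        (toFreeAlgebra R _) := by
    ext p
    simp [elimLie, elimAlg]
  exact DFunLike.congr_fun this u

open Classical in
/-- The action of the free algebra on the free algebra of the eliminated letters. -/
noncomputable def elimAction :
    FreeAlgebra R X →ₐ[R] Module.End R (FreeAlgebra R (ElimLetter x)) :=
  FreeAlgebra.lift R fun y =>
    if h : y = x then freeDerivation fun p => FreeAlgebra.ι R (p.1, p.2 + 1)
    else LinearMap.mulLeft R (FreeAlgebra.ι R (⟨y, h⟩, 0))

/-- For a derivation `D`, the commutator of `D` with left multiplication by `a` is left
multiplication by `D a`. With `x` acting by the shift `(y, k) ↦ (y, k + 1)`, each bracket with `x`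
raises the index by one. -/
theorem elimAction_adPow (y : {y : X // y ≠ x}) (k : ℕ) :
    elimAction R x (toFreeAlgebra R X (adPow R x (y, k))) =
      LinearMap.mulLeft R (FreeAlgebra.ι R (y, k)) := by
  induction k with
  | zero => simp [adPow, elimAction, y.2]
  | succ k ih =>
    rw [adPow_succ, LieHom.map_lie, LieRing.of_associative_ring_bracket, map_sub, map_mul, map_mul,
      ih]
    ext b
    simp [elimAction, freeDerivation_mul]

/-- Substitution followed by `elimAction` is the left regular representation, which is faithful:
evaluate at `1`. -/
theorem elimAlg_injective : Function.Injective (elimAlg R x) := by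
  have h : (elimAction R x).comp (elimAlg R x) = Algebra.lmul R _ := by
    ext1
    funext p
    have := elimAction_adPow R x p.1 p.2
    simp only [Function.comp_apply, AlgHom.comp_apply, elimAlg, FreeAlgebra.lift_ι_apply]
    exact this
  intro a b hab
  have h1 := DFunLike.congr_fun h a
  have h2 := DFunLike.congr_fun h b
  simp only [AlgHom.comp_apply, hab] at h1 h2
  simpa using DFunLike.congr_fun (h1.symm.trans h2) 1

variable {R}

/-- `ad x` is a derivation taking the letter `(y, k)` to `(y, k + 1)`, so it costs no length in the
new alphabet. -/
theorem exists_ad_elimLie {S : Finset (ElimLetter x)} {n : ℕ}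
    {u : FreeLieAlgebra R (ElimLetter x)} (hu : Fil S n u) :
    ∃ S' u', Fil S' n u' ∧ ⁅FreeLieAlgebra.of R x, elimLie R x u⁆ = elimLie R x u' := by
  classical
  induction hu with
  | zero n => exact ⟨∅, 0, .zero n, by simp⟩
  | add _ _ h1 h2 =>
    obtain ⟨S1, u1, hu1, e1⟩ := h1
    obtain ⟨S2, u2, hu2, e2⟩ := h2
    exact ⟨S1 ∪ S2, u1 + u2, (hu1.mono_set Finset.subset_union_left).add
      (hu2.mono_set Finset.subset_union_right), by simp [e1, e2]⟩
  | smul c _ h1 =>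
    obtain ⟨S1, u1, hu1, e1⟩ := h1
    exact ⟨S1, c • u1, hu1.smul c, by simp [e1]⟩
  | @of p _ =>
    refine ⟨{(p.1, p.2 + 1)}, FreeLieAlgebra.of R (p.1, p.2 + 1),
      .of (Finset.mem_singleton_self _), ?_⟩
    simp only [elimLie, FreeLieAlgebra.lift_of_apply, adPow_succ]
  | mono _ hmn h1 =>
    obtain ⟨S1, u1, hu1, e1⟩ := h1
    exact ⟨S1, u1, hu1.mono hmn, e1⟩
  | @lie m n a b ha hb h1 h2 =>
    obtain ⟨S1, u1, hu1, e1⟩ := h1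
    obtain ⟨S2, u2, hu2, e2⟩ := h2
    refine ⟨S ∪ S1 ∪ S2, ⁅u1, b⁆ + ⁅a, u2⁆, ((hu1.mono_set ?_).lie (hb.mono_set ?_)).add
      ((ha.mono_set ?_).lie (hu2.mono_set ?_)), ?_⟩
    any_goals grind
    rw [LieHom.map_lie, leibniz_lie, e1, e2]
    simp

open Classical in
/-- The map that kills `x` and sends every other letter `y` to `(y, 0)`. -/
noncomputable def killLie : FreeLieAlgebra R X →ₗ⁅R⁆ FreeLieAlgebra R (ElimLetter x) :=
  FreeLieAlgebra.lift R fun y => if h : y = x then 0 else FreeLieAlgebra.of R (⟨y, h⟩, 0)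

theorem exists_fil_killLie {S : Finset X} {n : ℕ} {z : FreeLieAlgebra R X} (hz : Fil S n z) :
    ∃ S', Fil S' n (killLie x z) := by
  classical
  refine ⟨(S.subtype (· ≠ x)).image fun y => (y, 0), ?_⟩
  induction hz with
  | zero n => rw [map_zero]; exact .zero n
  | add _ _ h1 h2 => rw [map_add]; exact h1.add h2
  | smul c _ h1 => rw [map_smul]; exact h1.smul c
  | @of y hy =>
    rw [killLie, FreeLieAlgebra.lift_of_apply]
    split_ifs with h
    · exact .zero 1
    · exact .of (by simp [hy])
  | mono _ hmn h1 => exact h1.mono hmn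
  | lie _ _ h1 h2 => rw [LieHom.map_lie]; exact h1.lie h2

/-- Every element is the sum of its part without `x`, a multiple of `x`, and an element of smaller
length in the eliminated letters. -/
theorem exists_elim {S : Finset X} {n : ℕ} {z : FreeLieAlgebra R X} (hz : Fil S n z) :
    ∃ (c : R) (S' : Finset (ElimLetter x)) (u : FreeLieAlgebra R (ElimLetter x)),
      Fil S' (n - 1) u ∧
        z = elimLie R x (killLie x z) + c • FreeLieAlgebra.of R x + elimLie R x u := by
  classical
  induction hz with
  | zero n => exact ⟨0, ∅, 0, .zero _, by simp⟩
  | add _ _ h1 h2 =>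
    obtain ⟨c1, S1, u1, hu1, e1⟩ := h1
    obtain ⟨c2, S2, u2, hu2, e2⟩ := h2
    refine ⟨c1 + c2, S1 ∪ S2, u1 + u2, (hu1.mono_set Finset.subset_union_left).add
      (hu2.mono_set Finset.subset_union_right), ?_⟩
    conv_lhs => rw [e1, e2]
    simp only [map_add, add_smul]
    abel
  | smul c _ h1 =>
    obtain ⟨c1, S1, u1, hu1, e1⟩ := h1
    refine ⟨c * c1, S1, c • u1, hu1.smul c, ?_⟩
    conv_lhs => rw [e1]
    simp only [map_smul, mul_smul, smul_add]
  | @of y hy =>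
    by_cases h : y = x
    · exact ⟨1, ∅, 0, .zero _, by simp [killLie, h]⟩
    · exact ⟨0, ∅, 0, .zero _, by simp [killLie, h, elimLie, adPow]⟩
  | mono _ hmn h1 =>
    obtain ⟨c1, S1, u1, hu1, e1⟩ := h1
    exact ⟨c1, S1, u1, hu1.mono (by omega), e1⟩
  | @lie m n a b ha hb h1 h2 =>
    -- The bounds below use `m, n ≥ 1`, since `m - 1` and `n - 1` are truncated.
    obtain rfl | hm := Nat.eq_zero_or_pos m
    · exact ⟨0, ∅, 0, .zero _, by simp [ha.eq_zero_of_length rfl]⟩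
    obtain rfl | hn := Nat.eq_zero_or_pos n
    · exact ⟨0, ∅, 0, .zero _, by simp [hb.eq_zero_of_length rfl]⟩
    obtain ⟨c1, S1, u1, hu1, e1⟩ := h1
    obtain ⟨c2, S2, u2, hu2, e2⟩ := h2
    obtain ⟨A, hA⟩ := exists_fil_killLie x ha
    obtain ⟨B, hB⟩ := exists_fil_killLie x hb
    obtain ⟨A1, a1, ha1, ea1⟩ := exists_ad_elimLie x hA
    obtain ⟨B1, b1, hb1, eb1⟩ := exists_ad_elimLie x hB
    obtain ⟨U1, v1, hv1, ev1⟩ := exists_ad_elimLie x hu1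
    obtain ⟨U2, v2, hv2, ev2⟩ := exists_ad_elimLie x hu2
    -- Write `a = a₀ + c1 x + u1` and `b = b₀ + c2 x + u2`. In `⁅a, b⁆` the term `⁅a₀, b₀⁆` is the
    -- part without `x` and `⁅x, x⁆ = 0`; the other seven products form the witness.
    refine ⟨0, A ∪ B ∪ A1 ∪ B1 ∪ U1 ∪ U2 ∪ S1 ∪ S2,
      ⁅killLie x a, u2⁆ + ⁅u1, killLie x b⁆ + ⁅u1, u2⁆ + c1 • b1 + (-c2) • a1 + c1 • v2 +
        (-c2) • v1, ?_, ?_⟩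
    · refine .add (.add (.add (.add (.add (.add (.mono (.lie (hA.mono_set ?_) (hu2.mono_set ?_)) ?_)
        (.mono (.lie (hu1.mono_set ?_) (hB.mono_set ?_)) ?_))
        (.mono (.lie (hu1.mono_set ?_) (hu2.mono_set ?_)) ?_))
        (.smul _ (.mono (hb1.mono_set ?_) ?_))) (.smul _ (.mono (ha1.mono_set ?_) ?_)))
        (.smul _ (.mono (hv2.mono_set ?_) ?_))) (.smul _ (.mono (hv1.mono_set ?_) ?_))
      all_goals first | omega | (intro p hp; simp [hp])
    · conv_lhs => rw [e1, e2]
      rw [← lie_skew (FreeLieAlgebra.of R x)] at ea1 ev1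
      have ea1' := neg_eq_iff_eq_neg.1 ea1
      have ev1' := neg_eq_iff_eq_neg.1 ev1
      simp only [add_lie, lie_add, smul_lie, lie_smul, LieHom.map_lie, map_add, map_smul, lie_self,
        ea1', eb1, ev1', ev2]
      module

/-- The coefficient of the letter `x`. -/
theorem smul_of_eq_zero {c : R} {u : FreeLieAlgebra R (ElimLetter x)}
    (h : toFreeAlgebra R X (c • FreeLieAlgebra.of R x + elimLie R x u) = 0) : c = 0 := by
  classical
  -- Since `R` is commutative, `e` kills brackets; it also kills the letters other than `x`, hence
  -- every `(ad x)^k y`.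
  let e : FreeAlgebra R X →ₐ[R] R := FreeAlgebra.lift R fun y => if y = x then 1 else 0
  have h0 : ((e : FreeAlgebra R X →ₗ⁅R⁆ R).comp (toFreeAlgebra R X)).comp (elimLie R x) = 0 := by
    ext ⟨y, k⟩
    cases k with
    | zero => simp [elimLie, adPow, e, y.2]
    | succ k =>
      simp [elimLie, adPow_succ, LieRing.of_associative_ring_bracket, mul_comm]
  have h1 := congrArg e h
  have h2 := DFunLike.congr_fun h0 u
  simp only [LieHom.comp_apply, AlgHom.toLieHom_apply] at h2
  rw [map_add, map_add, h2] at h1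
  simpa [e] using h1

end Elimination

/-- Double induction on length and, for fixed length, on the set of letters. Setting `x = 0` removes
a letter; once that part vanishes, elimination leaves an element of smaller length. The alphabet is
quantified inside because elimination replaces `X` by `ElimLetter x`. -/
theorem eq_zero_of_fil (n : ℕ) : ∀ {X : Type*} (S : Finset X)
    {z : FreeLieAlgebra R X}, Fil S n z → toFreeAlgebra R X z = 0 → z = 0 := by
  classical
  induction n with
  | zero => exact fun S z hz _ => hz.eq_zero_of_length rfl
  | succ n ih =>
    intro X S
    induction S using Finset.induction with
    | empty => exact fun hz _ => hz.eq_zero_of_letters rfl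
    | insert x S hx ihS =>
      intro z hz h0
      let k : FreeLieAlgebra R X →ₗ⁅R⁆ FreeLieAlgebra R X :=
        FreeLieAlgebra.lift R fun y => if y = x then 0 else FreeLieAlgebra.of R y
      let k' : FreeAlgebra R X →ₐ[R] FreeAlgebra R X :=
        FreeAlgebra.lift R fun y => if y = x then 0 else FreeAlgebra.ι R y
      have hk : (toFreeAlgebra R X).comp k =
          (k' : FreeAlgebra R X →ₗ⁅R⁆ FreeAlgebra R X).comp (toFreeAlgebra R X) := by
        ext y
        by_cases h : y = x <;> simp [k, k', h]
      -- `killLie x` factors through setting `x = 0`, so `k z = 0` is enough.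
      have hkk : (killLie x).comp k = (killLie x : FreeLieAlgebra R X →ₗ⁅R⁆ _) := by
        ext y
        by_cases h : y = x <;> simp [k, killLie, h]
      have hkz : k z = 0 := by
        refine ihS ?_ ?_
        · clear h0
          generalize n + 1 = m at hz
          induction hz with
          | zero n => rw [map_zero]; exact .zero n
          | add _ _ h1 h2 => rw [map_add]; exact h1.add h2
          | smul c _ h1 => rw [map_smul]; exact h1.smul c
          | @of y hy =>
            simp only [k, FreeLieAlgebra.lift_of_apply]
            split_ifs with h
            · exact .zero 1
            · exact .of ((Finset.mem_insert.1 hy).resolve_left h)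
          | mono _ hmn h1 => exact h1.mono hmn
          | lie _ _ h1 h2 => rw [LieHom.map_lie]; exact h1.lie h2
        · have := DFunLike.congr_fun hk z
          simpa [h0] using this
      have hz0 : killLie x z = 0 := by
        rw [← hkk, LieHom.comp_apply, hkz, map_zero]
      obtain ⟨c, S', u, hu, e⟩ := exists_elim x hz
      rw [hz0, map_zero, zero_add] at e
      have hc : c = 0 := smul_of_eq_zero x (e ▸ h0)
      rw [hc, zero_smul, zero_add] at e
      rw [e, toFreeAlgebra_elimLie] at h0
      rw [e, ih S' hu (elimAlg_injective R x (h0.trans (map_zero _).symm)), map_zero]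

/-- The free Lie algebra embeds in the free associative algebra. -/
theorem toFreeAlgebra_injective : Function.Injective (toFreeAlgebra R X) := by
  classical
  refine (injective_iff_map_eq_zero _).2 fun z hz => ?_
  obtain ⟨S, n, h⟩ := exists_fil z
  exact eq_zero_of_fil n S h hz

end FreeLieEmbedding

/-! ### Leading coefficients of a representation over power series -/

namespace DescendingCentral

open PowerSeries
open scoped commutatorElement

section Lead

variable {G S : Type*} [Group G] [Ring S] (ρ : G →* PowerSeries S)

/-- The subgroup of the elements that act as the identity modulo `X ^ p`. -/
def congruenceSubgroup (p : ℕ) : Subgroup G where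
  carrier := {g | X ^ p ∣ ρ g - 1}
  one_mem' := by simp
  mul_mem' := by
    intro g h hg hh
    have : ρ (g * h) - 1 = (ρ g - 1) * ρ h + (ρ h - 1) := by rw [map_mul]; noncomm_ring
    rw [Set.mem_ofPred_eq, this]
    exact dvd_add (hg.mul_right _) hh
  inv_mem' := by
    intro g hg
    have : ρ g⁻¹ - 1 = -((ρ g - 1) * ρ g⁻¹) := by
      rw [sub_mul, ← map_mul, mul_inv_cancel, map_one]; noncomm_ring
    rw [Set.mem_ofPred_eq, this]
    exact (hg.mul_right _).neg_right

variable {ρ}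

/-- The terms with a `1` cancel in `ρ g * ρ h - ρ h * ρ g`, leaving `X ^ (p + q) * (a * b - b * a)`;
multiply by the inverse of `ρ (h * g)`. -/
theorem map_commutator_eq {p q : ℕ} {g h : G} {a b : PowerSeries S} (hg : ρ g = 1 + X ^ p * a)
    (hh : ρ h = 1 + X ^ q * b) :
    ρ ⁅g, h⁆ = 1 + X ^ (p + q) * ((a * b - b * a) * ρ (g⁻¹ * h⁻¹)) := by
  have h1 : ρ g * ρ h = ρ h * ρ g + X ^ (p + q) * (a * b - b * a) := by
    have e1 : X ^ p * a * (X ^ q * b) = X ^ (p + q) * (a * b) := by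
      rw [pow_add, mul_assoc, ← mul_assoc a, (commute_X_pow a q).eq]
      simp only [mul_assoc]
    have e2 : X ^ q * b * (X ^ p * a) = X ^ (p + q) * (b * a) := by
      rw [add_comm p q, pow_add, mul_assoc, ← mul_assoc b, (commute_X_pow b p).eq]
      simp only [mul_assoc]
    rw [hg, hh, mul_sub, ← e1, ← e2]
    noncomm_ring
  have h2 : ρ h * ρ g * ρ (g⁻¹ * h⁻¹) = 1 := by
    rw [← map_mul, ← map_mul]; simp
  have h3 : ⁅g, h⁆ = g * h * (g⁻¹ * h⁻¹) := by rw [commutatorElement_def]; group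
  rw [h3, map_mul, map_mul, h1, add_mul, h2, mul_assoc]

theorem commutator_congruenceSubgroup_le (p q : ℕ) :
    ⁅congruenceSubgroup ρ p, congruenceSubgroup ρ q⁆ ≤ congruenceSubgroup ρ (p + q) := by
  refine Subgroup.commutator_le.2 fun g ⟨a, ha⟩ h ⟨b, hb⟩ => ?_
  have := map_commutator_eq (sub_eq_iff_eq_add'.1 ha) (sub_eq_iff_eq_add'.1 hb)
  exact ⟨_, sub_eq_iff_eq_add'.2 this⟩

/-- A representation trivial modulo `X` is trivial modulo `X ^ p` on `Γᵖ`, so the coefficient of `X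
^ p` is the leading one there. -/
theorem Gam_le_congruenceSubgroup (h0 : ∀ g, constantCoeff (ρ g) = 1) (p : ℕ) : Gam G p ≤ congruenceSubgroup ρ p := by
  have h1 : ∀ g, g ∈ congruenceSubgroup ρ 1 := fun g => by
    change (X : PowerSeries S) ^ 1 ∣ ρ g - 1
    rw [pow_one, X_dvd_iff, map_sub, h0, map_one, sub_self]
  induction p with
  | zero => intro g _; change (X : PowerSeries S) ^ 0 ∣ _; simp
  | succ p ih =>
    cases p with
    | zero => exact fun g _ => h1 g
    | succ p =>
      rw [Gam_succ_succ]
      exact (Subgroup.commutator_mono ih fun g _ => h1 g).trans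
        (commutator_congruenceSubgroup_le _ _)

theorem exists_eq_of_mem_Gam (h0 : ∀ g, constantCoeff (ρ g) = 1) {p : ℕ} {g : G} (hg : g ∈ Gam G p) :
    ∃ a, ρ g = 1 + X ^ p * a := by
  obtain ⟨a, ha⟩ := Gam_le_congruenceSubgroup h0 p hg
  exact ⟨a, sub_eq_iff_eq_add'.1 ha⟩

theorem coeff_eq_of_eq {p : ℕ} (hp : 0 < p) {f a : PowerSeries S} (h : f = 1 + X ^ p * a) :
    coeff p f = constantCoeff a := by
  rw [h, map_add, coeff_one, if_neg hp.ne', zero_add]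
  simpa using coeff_X_pow_mul a p 0

theorem coeff_mul_of_mem_Gam (h0 : ∀ g, constantCoeff (ρ g) = 1) {p : ℕ} (hp : 0 < p) {g h : G} (hg : g ∈ Gam G p)
    (hh : h ∈ Gam G p) : coeff p (ρ (g * h)) = coeff p (ρ g) + coeff p (ρ h) := by
  obtain ⟨a, ha⟩ := exists_eq_of_mem_Gam h0 hg
  obtain ⟨b, hb⟩ := exists_eq_of_mem_Gam h0 hh
  have : ρ (g * h) = 1 + X ^ p * (a * ρ h + b) := by
    rw [map_mul, ha, add_mul, one_mul]
    nth_rewrite 1 [hb]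
    noncomm_ring
  rw [coeff_eq_of_eq hp ha, coeff_eq_of_eq hp hb, coeff_eq_of_eq hp this, map_add, map_mul, h0,
    mul_one]

theorem coeff_commutator (h0 : ∀ g, constantCoeff (ρ g) = 1) {p q : ℕ} (hp : 0 < p) (hq : 0 < q) {g h : G} (hg : g ∈ Gam G p)
    (hh : h ∈ Gam G q) : coeff (p + q) (ρ ⁅g, h⁆) =
      coeff p (ρ g) * coeff q (ρ h) - coeff q (ρ h) * coeff p (ρ g) := by
  obtain ⟨a, ha⟩ := exists_eq_of_mem_Gam h0 hg
  obtain ⟨b, hb⟩ := exists_eq_of_mem_Gam h0 hh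
  rw [coeff_eq_of_eq hp ha, coeff_eq_of_eq hq hb,
    coeff_eq_of_eq (by omega) (map_commutator_eq ha hb), map_mul, h0, mul_one]
  simp

/-- The leading coefficient on `gr_p(G)`. -/
noncomputable def leadPiece (h0 : ∀ g, constantCoeff (ρ g) = 1) (p : ℕ+) : GrPiece G p →+ S :=
  MonoidHom.toAdditiveLeft (QuotientGroup.lift _
    (MonoidHom.mk' (fun g : Gam G p => Multiplicative.ofAdd (coeff (p : ℕ) (ρ (g : G))))
      fun g h => congrArg Multiplicative.ofAdd (coeff_mul_of_mem_Gam h0 p.pos g.2 h.2))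
    (by
      intro g hg
      rw [Subgroup.mem_subgroupOf] at hg
      obtain ⟨a, ha⟩ := exists_eq_of_mem_Gam h0 hg
      have : coeff (p : ℕ) (ρ (g : G)) = 0 := by
        rw [pow_succ, mul_assoc] at ha
        rw [coeff_eq_of_eq p.pos ha]
        simp
      exact congrArg Multiplicative.ofAdd this))

/-- The additive map from `gr_*(G)` to `S` given by leading coefficients. -/
noncomputable def lead (h0 : ∀ g, constantCoeff (ρ g) = 1) : Gr G →+ S :=
  DirectSum.toAddMonoid (leadPiece h0)

theorem lead_elt (h0 : ∀ g, constantCoeff (ρ g) = 1) {p : ℕ+} {g : G} (hg : g ∈ Gam G p) :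
    lead h0 (Gr.elt p g hg) = coeff (p : ℕ) (ρ g) :=
  DirectSum.toAddMonoid_of _ _ _

/-- The leading coefficients are compatible with brackets. -/
theorem lead_lie (h0 : ∀ g, constantCoeff (ρ g) = 1) (x y : Gr G) :
    lead h0 ⁅x, y⁆ = lead h0 x * lead h0 y - lead h0 y * lead h0 x := by
  induction x using Gr.induction with
  | h0 => simp
  | h2 a b ha hb => simp only [add_lie, map_add, ha, hb]; noncomm_ring
  | h1 p x hx =>
    induction y using Gr.induction with
    | h0 => simp
    | h2 a b ha hb => simp only [lie_add, map_add, ha, hb]; noncomm_ring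
    | h1 q y hy =>
      rw [Gr.bracket_elt, lead_elt, lead_elt, lead_elt]
      exact coeff_commutator h0 p.pos q.pos hx hy

end Lead

end DescendingCentral

/-! ### The Magnus representation of the automorphism group of a free group -/

namespace Magnus

open PowerSeries FreeLieEmbedding

variable (R : Type*) [CommRing R] {X : Type*}

theorem isUnit_one_add (x : X) :
    IsUnit (1 + PowerSeries.X * C (FreeAlgebra.ι R x) : PowerSeries (FreeAlgebra R X)) := by
  rw [isUnit_iff_constantCoeff]
  simp

/-- The Magnus expansion `x ↦ 1 + x t`. -/
noncomputable def magnus : FreeGroup X →* (PowerSeries (FreeAlgebra R X))ˣ :=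
  FreeGroup.lift fun x => (isUnit_one_add R x).unit

@[simp]
theorem magnus_of (x : X) :
    (magnus R (FreeGroup.of x) : PowerSeries (FreeAlgebra R X)) =
      1 + PowerSeries.X * C (FreeAlgebra.ι R x) := by
  simp [magnus]

theorem constantCoeff_magnus (w : FreeGroup X) :
    constantCoeff (magnus R w : PowerSeries (FreeAlgebra R X)) = 1 := by
  have : (constantCoeff (R := FreeAlgebra R X)).toMonoidHom.comp ((Units.coeHom _).comp (magnus R)) =
      (1 : FreeGroup X →* _) := by
    ext x
    simp
  exact DFunLike.congr_fun this w

/-- The power series `a` with `magnus w = 1 + t a`. -/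
noncomputable def shift (w : FreeGroup X) : PowerSeries (FreeAlgebra R X) :=
  PowerSeries.mk fun n => coeff (n + 1) (magnus R w : PowerSeries (FreeAlgebra R X))

theorem magnus_eq (w : FreeGroup X) :
    (magnus R w : PowerSeries (FreeAlgebra R X)) = 1 + PowerSeries.X * shift R w := by
  have := sub_const_eq_X_mul_shift (magnus R w : PowerSeries (FreeAlgebra R X))
  rw [constantCoeff_magnus, map_one] at this
  exact sub_eq_iff_eq_add'.1 this

/-- The substitution `x ↦ (magnus (g x) - 1) / t`. -/
noncomputable def subst (g : MulAut (FreeGroup X)) :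
    FreeAlgebra R X →ₐ[R] PowerSeries (FreeAlgebra R X) :=
  FreeAlgebra.lift R fun x => shift R (g (FreeGroup.of x))

/-- Left multiplication, coefficientwise. -/
noncomputable def leftMul :
    PowerSeries (FreeAlgebra R X) →+* PowerSeries (Module.End R (FreeAlgebra R X)) :=
  PowerSeries.map (Algebra.lmul R (FreeAlgebra R X)).toRingHom

theorem coeff_leftMul_apply (f : PowerSeries (FreeAlgebra R X)) (m : ℕ) (b : FreeAlgebra R X) :
    coeff m (leftMul R f) b = coeff m f * b := by
  simp [leftMul]

/-- The power series of endomorphisms of the free algebra defined by an automorphism of the free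
group. -/
noncomputable def repAux (g : MulAut (FreeGroup X)) :
    PowerSeries (Module.End R (FreeAlgebra R X)) :=
  PowerSeries.mk fun m =>
    (coeff (R := FreeAlgebra R X) m).restrictScalars R ∘ₗ (subst R g).toLinearMap

theorem coeff_repAux_apply (g : MulAut (FreeGroup X)) (m : ℕ) (b : FreeAlgebra R X) :
    coeff m (repAux R g) b = coeff m (subst R g b) := by
  simp [repAux]

theorem coeff_mul_apply (f f' : PowerSeries (Module.End R (FreeAlgebra R X))) (m : ℕ)
    (b : FreeAlgebra R X) : coeff m (f * f') b =
      ∑ p ∈ Finset.HasAntidiagonal.antidiagonal m, coeff p.1 f (coeff p.2 f' b) := by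
  rw [coeff_mul, LinearMap.sum_apply]
  rfl

/-- Cancelling the summand `1` and the central factor `t` passes between letters of the algebra,
where the substitution is defined, and group elements, where automorphisms compose. -/
theorem semiconj_iff (f : PowerSeries (Module.End R (FreeAlgebra R X))) (x : X) (w : FreeGroup X) :
    SemiconjBy f (leftMul R (magnus R (FreeGroup.of x))) (leftMul R (magnus R w)) ↔
      f * leftMul R (C (FreeAlgebra.ι R x)) = leftMul R (shift R w) * f := by
  have hX : leftMul R (PowerSeries.X : PowerSeries (FreeAlgebra R X)) = PowerSeries.X := by
    simp [leftMul]
  rw [SemiconjBy, magnus_of, magnus_eq R w, map_add, map_add, map_mul, map_mul, hX, map_one,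
    mul_add, add_mul, mul_one, one_mul, add_right_inj, ← mul_assoc, (commute_X f).eq, mul_assoc,
    mul_assoc]
  exact ⟨fun h => X_mul_cancel h, fun h => by rw [h]⟩

theorem repAux_mul_leftMul (g : MulAut (FreeGroup X)) (x : X) :
    repAux R g * leftMul R (C (FreeAlgebra.ι R x)) =
      leftMul R (shift R (g (FreeGroup.of x))) * repAux R g := by
  ext m : 1
  ext1 b
  have h1 : coeff m (repAux R g * leftMul R (C (FreeAlgebra.ι R x))) b =
      coeff m (repAux R g) (FreeAlgebra.ι R x * b) := by
    rw [leftMul, map_C, coeff_mul_C]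
    rfl
  rw [h1, coeff_repAux_apply, map_mul, coeff_mul_apply, coeff_mul]
  refine Finset.sum_congr rfl fun p _ => ?_
  rw [coeff_leftMul_apply, coeff_repAux_apply, subst, FreeAlgebra.lift_ι_apply]

/-- Intertwining passes from generators to products and inverses, so the substitution realizes `g`
on every Magnus expansion. -/
theorem semiconjBy_repAux (g : MulAut (FreeGroup X)) (w : FreeGroup X) :
    SemiconjBy (repAux R g) (leftMul R (magnus R w)) (leftMul R (magnus R (g w))) := by
  let u : FreeGroup X →* (PowerSeries (Module.End R (FreeAlgebra R X)))ˣ :=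
    (Units.map (leftMul R).toMonoidHom).comp (magnus R)
  change SemiconjBy (repAux R g) (u w) (u (g w))
  have hof : ∀ x, SemiconjBy (repAux R g) (u (FreeGroup.of x)) (u (g (FreeGroup.of x))) :=
    fun x => (semiconj_iff R _ _ _).2 (repAux_mul_leftMul R g x)
  induction w using FreeGroup.induction_on with
  | C1 => simp
  | of x => exact hof x
  | inv_of x _ => simpa using (hof x).units_inv_right
  | mul a b ha hb => simpa using ha.mul_right hb

/-- The relation computes `f` at `x * b` from `f` at `b`, so the values at `1` determine `f`. This
uniqueness gives multiplicativity of `rep` without composing substitutions. -/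
theorem eq_of_semiconj {f f' : PowerSeries (Module.End R (FreeAlgebra R X))}
    (A : X → PowerSeries (FreeAlgebra R X))
    (hf : ∀ x, f * leftMul R (C (FreeAlgebra.ι R x)) = leftMul R (A x) * f)
    (hf' : ∀ x, f' * leftMul R (C (FreeAlgebra.ι R x)) = leftMul R (A x) * f')
    (h1 : ∀ m, coeff m f 1 = coeff m f' 1) : f = f' := by
  have hC : ∀ (f : PowerSeries (Module.End R (FreeAlgebra R X))) (m : ℕ) (x : X) (b : FreeAlgebra R X),
      coeff m (f * leftMul R (C (FreeAlgebra.ι R x))) b = coeff m f (FreeAlgebra.ι R x * b) := by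
    intro f m x b
    rw [leftMul, map_C, coeff_mul_C]
    rfl
  have key : ∀ a b, (∀ m, coeff m f b = coeff m f' b) →
      ∀ m, coeff m f (a * b) = coeff m f' (a * b) := by
    intro a
    induction a using FreeAlgebra.induction with
    | grade0 r => intro b hb m; rw [← Algebra.smul_def, map_smul, map_smul, hb]
    | grade1 x =>
      intro b hb m
      rw [← hC, ← hC, hf, hf', coeff_mul_apply, coeff_mul_apply]
      simp only [hb]
    | mul a a' ha ha' => intro b hb m; rw [mul_assoc]; exact ha _ (ha' b hb) m
    | add a a' ha ha' => intro b hb m; rw [add_mul, map_add, map_add, ha b hb, ha' b hb]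
  ext m : 1
  ext1 b
  simpa using key b 1 h1 m

theorem coeff_repAux_one (g : MulAut (FreeGroup X)) (m : ℕ) :
    coeff m (repAux R g) 1 = if m = 0 then 1 else 0 := by
  rw [coeff_repAux_apply, map_one, coeff_one]

/-- The Magnus representation of the automorphism group of a free group by power series with
coefficients in the endomorphisms of the free algebra. -/
noncomputable def rep :
    MulAut (FreeGroup X) →* PowerSeries (Module.End R (FreeAlgebra R X)) where
  toFun := repAux R
  map_one' := by
    refine eq_of_semiconj R _ (repAux_mul_leftMul R 1)
      (fun x => (semiconj_iff R 1 x _).1 (SemiconjBy.one_left _)) fun m => ?_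
    rw [coeff_repAux_one, coeff_one]
    split_ifs <;> rfl
  map_mul' g h := by
    refine eq_of_semiconj R _ (repAux_mul_leftMul R (g * h))
      (fun x => (semiconj_iff R _ x _).1
        ((semiconjBy_repAux R g _).mul_left (semiconjBy_repAux R h _))) fun m => ?_
    -- `repAux R h` maps `1` to `1` with no higher terms, so only the index `(m, 0)` contributes.
    rw [coeff_repAux_one, coeff_mul_apply, Finset.sum_eq_single (m, 0)]
    · rw [coeff_repAux_one R h, if_pos rfl, coeff_repAux_one]
    · rintro ⟨i, j⟩ hij hne
      have hj : j ≠ 0 := by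
        rintro rfl
        exact hne (by simpa using hij)
      simp [coeff_repAux_one, hj]
    · simp

theorem coeff_rep_apply (g : MulAut (FreeGroup X)) (m : ℕ) (b : FreeAlgebra R X) :
    coeff m (rep R g) b = coeff m (subst R g b) :=
  coeff_repAux_apply R g m b

variable {R}

/-- The hypothesis says that `g` fixes the degree 1 part of each Magnus expansion, so the
substitution starts with the identity. -/
theorem constantCoeff_subst {g : MulAut (FreeGroup X)}
    (hg : ∀ x, coeff 1 (magnus R (g (FreeGroup.of x)) : PowerSeries (FreeAlgebra R X)) =
      FreeAlgebra.ι R x) (b : FreeAlgebra R X) : constantCoeff (subst R g b) = b := by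
  induction b using FreeAlgebra.induction with
  | grade0 r => simp [PowerSeries.algebraMap_apply]
  | grade1 x => simpa [subst, shift, ← coeff_zero_eq_constantCoeff_apply] using hg x
  | mul a b ha hb => rw [map_mul, map_mul, ha, hb]
  | add a b ha hb => rw [map_add, map_add, ha, hb]

theorem constantCoeff_rep {g : MulAut (FreeGroup X)}
    (hg : ∀ x, coeff 1 (magnus R (g (FreeGroup.of x)) : PowerSeries (FreeAlgebra R X)) =
      FreeAlgebra.ι R x) : constantCoeff (rep R g) = 1 := by
  ext1 b
  rw [← coeff_zero_eq_constantCoeff_apply, coeff_rep_apply, coeff_zero_eq_constantCoeff_apply,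
    constantCoeff_subst hg]
  rfl

theorem derivation_ext {D D' : Module.End R (FreeAlgebra R X)}
    (h : ∀ a b, D (a * b) = D a * b + a * D b) (h' : ∀ a b, D' (a * b) = D' a * b + a * D' b)
    (hx : ∀ x, D (FreeAlgebra.ι R x) = D' (FreeAlgebra.ι R x)) : D = D' := by
  have h1 : D 1 = 0 := by simpa using h 1 1
  have h1' : D' 1 = 0 := by simpa using h' 1 1
  ext1 b
  induction b using FreeAlgebra.induction with
  | grade0 r => rw [Algebra.algebraMap_eq_smul_one, map_smul, map_smul, h1, h1']
  | grade1 x => exact hx x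
  | mul a b ha hb => rw [h, h', ha, hb]
  | add a b ha hb => rw [map_add, map_add, ha, hb]

/-- The coefficient of `t` in a multiplicative substitution starting with the identity is a
derivation, hence determined by its values on letters. -/
theorem coeff_one_rep {g : MulAut (FreeGroup X)}
    (hg : ∀ x, coeff 1 (magnus R (g (FreeGroup.of x)) : PowerSeries (FreeAlgebra R X)) =
      FreeAlgebra.ι R x) : coeff 1 (rep R g) = freeDerivation fun x =>
        coeff 2 (magnus R (g (FreeGroup.of x)) : PowerSeries (FreeAlgebra R X)) := by
  refine derivation_ext (fun a b => ?_) (freeDerivation_mul _) fun x => ?_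
  · simp only [coeff_rep_apply, map_mul, coeff_mul]
    rw [Finset.Nat.sum_antidiagonal_eq_sum_range_succ_mk]
    simp [Finset.sum_range_succ, constantCoeff_subst hg, add_comm]
  · simp [coeff_rep_apply, subst, shift]

end Magnus

/-! ### The Magnus representation on the generators `α_{ij}`. -/

namespace McCool

open PowerSeries Magnus FreeLieEmbedding

variable {n : ℕ}

theorem alpha_of_self (i j : Fin n) : alpha i j (FreeGroup.of i) =
    FreeGroup.of j * FreeGroup.of i * (FreeGroup.of j)⁻¹ :=
  conjEnd_self i _

theorem alpha_of_ne {i r : Fin n} (h : r ≠ i) (j : Fin n) :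
    alpha i j (FreeGroup.of r) = FreeGroup.of r :=
  conjEnd_ne h _

/-- The expansions of `x_j x_i` and `x_i x_j` differ by exactly `t² [x_j, x_i]`; multiply by the
expansion of `x_j⁻¹`. -/
theorem magnus_conj (i j : Fin n) :
    ∃ f : PowerSeries (FreeAlgebra ℤ (Fin n)), constantCoeff f = 1 ∧
      (magnus ℤ (FreeGroup.of j * FreeGroup.of i * (FreeGroup.of j)⁻¹) :
        PowerSeries (FreeAlgebra ℤ (Fin n))) = 1 + PowerSeries.X * C (FreeAlgebra.ι ℤ i) +
          PowerSeries.X ^ 2 * (C (FreeAlgebra.ι ℤ j * FreeAlgebra.ι ℤ i -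
            FreeAlgebra.ι ℤ i * FreeAlgebra.ι ℤ j) * f) := by
  refine ⟨(magnus ℤ (FreeGroup.of j)⁻¹ : (PowerSeries (FreeAlgebra ℤ (Fin n)))ˣ),
    constantCoeff_magnus ℤ _, ?_⟩
  have hu : (magnus ℤ (FreeGroup.of j)).val * (magnus ℤ (FreeGroup.of j)⁻¹).val = 1 := by
    rw [map_inv, Units.mul_inv]
  have huv : (magnus ℤ (FreeGroup.of j)).val * (magnus ℤ (FreeGroup.of i)).val =
      (magnus ℤ (FreeGroup.of i)).val * (magnus ℤ (FreeGroup.of j)).val +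
        PowerSeries.X ^ 2 * C (FreeAlgebra.ι ℤ j * FreeAlgebra.ι ℤ i -
            FreeAlgebra.ι ℤ i * FreeAlgebra.ι ℤ j) := by
    have hc : ∀ a b : FreeAlgebra ℤ (Fin n), (PowerSeries.X * C a) * (PowerSeries.X * C b) =
        PowerSeries.X ^ 2 * C (a * b) := by
      intro a b
      rw [mul_assoc, ← mul_assoc (C a), (commute_X (C a)).eq, pow_two, map_mul]
      simp only [mul_assoc]
    simp only [magnus_of, map_sub, mul_sub, ← hc]
    noncomm_ring
  rw [map_mul, map_mul, Units.val_mul, Units.val_mul, huv, add_mul, mul_assoc, hu, mul_one,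
    magnus_of, mul_assoc]

theorem coeff_one_magnus_alpha (i j x : Fin n) :
    coeff 1 (magnus ℤ (alpha i j (FreeGroup.of x)) : PowerSeries (FreeAlgebra ℤ (Fin n))) =
      FreeAlgebra.ι ℤ x := by
  by_cases h : x = i
  · subst h
    obtain ⟨f, -, e⟩ := magnus_conj x j
    rw [alpha_of_self, e, map_add, coeff_X_pow_mul']
    simp [coeff_one]
  · rw [alpha_of_ne h]
    simp [coeff_one]

theorem coeff_two_magnus_alpha (i j x : Fin n) :
    coeff 2 (magnus ℤ (alpha i j (FreeGroup.of x)) : PowerSeries (FreeAlgebra ℤ (Fin n))) =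
      if x = i then FreeAlgebra.ι ℤ j * FreeAlgebra.ι ℤ i - FreeAlgebra.ι ℤ i * FreeAlgebra.ι ℤ j
      else 0 := by
  have h2 : coeff 2 (PowerSeries.X * C (FreeAlgebra.ι ℤ x)) = 0 := by
    rw [coeff_succ_X_mul, coeff_C, if_neg one_ne_zero]
  by_cases h : x = i
  · subst h
    obtain ⟨f, hf, e⟩ := magnus_conj x j
    rw [alpha_of_self, e, map_add, map_add, h2, coeff_X_pow_mul', if_pos rfl, if_pos le_rfl]
    simp [coeff_one, hf]
  · rw [alpha_of_ne h, if_neg h, magnus_of, map_add, h2]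
    simp [coeff_one]

/-- The Magnus representation of the upper triangular McCool group. -/
noncomputable def repPlus (n : ℕ) :
    PSigmaPlus n →* PowerSeries (Module.End ℤ (FreeAlgebra ℤ (Fin n))) :=
  (rep ℤ).comp (PSigmaPlus n).subtype

theorem constantCoeff_repPlus (g : PSigmaPlus n) : constantCoeff (repPlus n g) = 1 := by
  obtain ⟨g, hg⟩ := g
  change constantCoeff (rep ℤ g) = 1
  induction hg using Subgroup.closure_induction with
  | mem g h =>
    obtain ⟨i, j, -, rfl⟩ := h
    exact constantCoeff_rep (coeff_one_magnus_alpha i j)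
  | one => simp
  | mul g h _ _ hg hh => rw [map_mul, map_mul, hg, hh, mul_one]
  | inv g _ hg =>
    have : constantCoeff (rep ℤ (g * g⁻¹)) = 1 := by simp
    rwa [map_mul, map_mul, hg, one_mul] at this

/-- The Johnson homomorphism from the associated graded Lie ring to the endomorphisms of the free
algebra. -/
noncomputable def johnson (n : ℕ) :
    DescendingCentral.Gr (PSigmaPlus n) →+ Module.End ℤ (FreeAlgebra ℤ (Fin n)) :=
  DescendingCentral.lead constantCoeff_repPlus

theorem johnson_gen (q : Idx n) (j : Fin (q - 1)) :
    johnson n (DescendingCentral.Gr.of 1 (cls₁ (gen q j))) = freeDerivation fun x : Fin n =>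
      if (x : ℕ) = q - 1 then FreeAlgebra.ι ℤ (⟨j, by have := Finset.mem_Icc.1 q.2; omega⟩ : Fin n) *
        FreeAlgebra.ι ℤ x - FreeAlgebra.ι ℤ x *
          FreeAlgebra.ι ℤ (⟨j, by have := Finset.mem_Icc.1 q.2; omega⟩ : Fin n)
      else 0 := by
  have h := DescendingCentral.lead_elt constantCoeff_repPlus (p := 1)
    (DescendingCentral.mem_Gam_one (gen q j))
  refine h.trans ((coeff_one_rep (coeff_one_magnus_alpha _ _)).trans (congrArg _ ?_))
  funext x
  rw [coeff_two_magnus_alpha]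
  by_cases hx : (x : ℕ) = q - 1
  · have hx' : x = ⟨q - 1, by have := x.2; omega⟩ := Fin.ext hx
    rw [if_pos hx', if_pos hx, ← hx']
  · rw [if_neg hx, if_neg fun e => hx (congrArg Fin.val e)]

end McCool

/-! ### The free Lie algebra as a subalgebra of the tensor algebra -/

namespace FreeLieEmbedding

attribute [local instance] LieRing.ofAssociativeRing

theorem freeLie_induction {R X : Type*} [CommRing R] {C : FreeLieAlgebra R X → Prop}
    (zero : C 0)
    (of : ∀ x, C (FreeLieAlgebra.of R x)) (add : ∀ a b, C a → C b → C (a + b))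
    (smul : ∀ (c : R) a, C a → C (c • a)) (lie : ∀ a b, C a → C b → C ⁅a, b⁆)
    (z : FreeLieAlgebra R X) : C z := by
  classical
  obtain ⟨S, n, h⟩ := exists_fil z
  induction h with
  | zero n => exact zero
  | add _ _ h1 h2 => exact add _ _ h1 h2
  | smul c _ h1 => exact smul _ _ h1
  | of _ => exact of _
  | mono _ _ h1 => exact h1
  | lie _ _ h1 h2 => exact lie _ _ h1 h2

/-- Integer multiples are iterated sums and negatives, so closure under scalars comes for free. -/
theorem freeLie_int_induction {X : Type*} {C : FreeLieAlgebra ℤ X → Prop}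
    (zero : C 0) (of : ∀ x, C (FreeLieAlgebra.of ℤ x)) (add : ∀ a b, C a → C b → C (a + b))
    (neg : ∀ a, C a → C (-a)) (lie : ∀ a b, C a → C b → C ⁅a, b⁆)
    (z : FreeLieAlgebra ℤ X) : C z := by
  refine freeLie_induction zero of add (fun c a ha => ?_) lie z
  induction c with
  | zero => exact (congrArg C (zero_zsmul a)).mpr zero
  | succ c ih =>
    have h := (add_zsmul a c 1).trans (congrArg _ (one_zsmul a))
    exact (congrArg C h).mpr (add _ _ ih ha)
  | pred c ih =>
    have h := (sub_zsmul a (-c) 1).trans (congrArg (fun b => -(c : ℤ) • a + -b) (one_zsmul a))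
    exact (congrArg C h).mpr (add _ _ ih (neg a ha))

/-- The canonical map from the free Lie algebra to `L[V_m]`. -/
noncomputable def toFreeLie (m : ℕ) :
    FreeLieAlgebra ℤ (Fin m) →ₗ⁅ℤ⁆ FreeLie.freeLie (FreeAb m) :=
  FreeLieAlgebra.lift ℤ fun j => FreeLie.inj (Pi.single j 1)

theorem toFreeLie_of {m : ℕ} (j : Fin m) :
    toFreeLie m (FreeLieAlgebra.of ℤ j) = FreeLie.inj (Pi.single j 1) :=
  FreeLieAlgebra.lift_of_apply _ _

/-- Under the identification of the tensor algebra with the free algebra this map becomes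
`toFreeAlgebra`. -/
theorem toFreeLie_injective (m : ℕ) : Function.Injective (toFreeLie m) := by
  have h : ∀ u, TensorAlgebra.equivFreeAlgebra (Pi.basisFun ℤ (Fin m))
      (toFreeLie m u : TensorAlgebra ℤ (FreeAb m)) = toFreeAlgebra ℤ (Fin m) u := by
    intro u
    induction u using freeLie_int_induction with
    | of x =>
      rw [toFreeLie_of, toFreeAlgebra_of]
      have := TensorAlgebra.equivFreeAlgebra_ι_apply (Pi.basisFun ℤ (Fin m)) x
      rw [Pi.basisFun_apply] at this
      exact this
    | zero => simp
    | add a b ha hb => simp [ha, hb]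
    | neg a ha => simp [ha]
    | lie a b ha hb => simp [ha, hb, LieRing.of_associative_ring_bracket]
  intro a b hab
  apply toFreeAlgebra_injective
  rw [← h, ← h, hab]

theorem toFreeLie_surjective (m : ℕ) : Function.Surjective (toFreeLie m) := by
  rintro ⟨z, hz⟩
  suffices h : ∃ u, (toFreeLie m u : TensorAlgebra ℤ (FreeAb m)) = z from
    h.imp fun u hu => Subtype.ext hu
  induction hz using LieSubalgebra.lieSpan_induction with
  | mem z hz =>
    obtain ⟨v, rfl⟩ := hz
    refine ⟨∑ j, v j • FreeLieAlgebra.of ℤ j, ?_⟩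
    have hv : v = ∑ j, v j • Pi.single j (1 : ℤ) := by
      ext i
      simp [Finset.sum_apply, Pi.single_apply]
    conv_rhs => rw [hv, map_sum]
    change (FreeLie.freeLie (FreeAb m)).incl.comp (toFreeLie m) _ = _
    rw [map_sum]
    refine Finset.sum_congr rfl fun j _ => ?_
    rw [map_smul, map_smul, LieHom.comp_apply, toFreeLie_of]
    rfl
  | zero => exact ⟨0, by simp⟩
  | add a b _ _ ha hb =>
    obtain ⟨u, rfl⟩ := ha
    obtain ⟨v, rfl⟩ := hb
    exact ⟨u + v, by simp⟩
  | smul c a _ ha =>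
    obtain ⟨u, rfl⟩ := ha
    exact ⟨c • u, by simp⟩
  | lie a b _ _ ha hb =>
    obtain ⟨u, rfl⟩ := ha
    obtain ⟨v, rfl⟩ := hb
    exact ⟨⁅u, v⁆, by simp⟩

/-- `L[V_m]` is the free Lie algebra on the standard basis of `V_m`. -/
noncomputable def equivFreeLie (m : ℕ) :
    FreeLieAlgebra ℤ (Fin m) ≃ₗ⁅ℤ⁆ FreeLie.freeLie (FreeAb m) :=
  LieEquiv.ofBijective (toFreeLie m) ⟨toFreeLie_injective m, toFreeLie_surjective m⟩

end FreeLieEmbedding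

/-! ### Generation of the associated graded Lie ring -/

namespace DescendingCentral

/-- `Γᵖ⁺¹` is generated as a group by commutators of `Γᵖ` with `G`, whose classes are brackets with
degree 1; hence degree 1 generates everything. -/
theorem eq_top_of_lie_mem {G : Type*} [Group G] (M : AddSubgroup (Gr G))
    (hlie : ∀ x ∈ M, ∀ y ∈ M, ⁅x, y⁆ ∈ M) (h1 : ∀ g, Gr.of 1 (McCool.cls₁ g) ∈ M) : M = ⊤ := by
  have key : ∀ (p : ℕ) (g : G) (hg : g ∈ Gam G (p + 1)), Gr.elt p.succPNat g hg ∈ M := by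
    intro p
    induction p with
    | zero => exact fun g _ => h1 g
    | succ p ih =>
      let H : Subgroup G :=
        { carrier := {g | ∃ hg : g ∈ Gam G (p + 1 + 1), Gr.elt (p + 1).succPNat g hg ∈ M}
          one_mem' := ⟨one_mem _, by rw [Gr.elt_one]; exact zero_mem M⟩
          mul_mem' := by
            rintro a b ⟨ha, ha'⟩ ⟨hb, hb'⟩
            exact ⟨mul_mem ha hb, by
              rw [← Gr.elt_add (p := (p + 1).succPNat) ha hb]; exact add_mem ha' hb'⟩
          inv_mem' := by
            rintro a ⟨ha, ha'⟩
            exact ⟨inv_mem ha, by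
              rw [← Gr.neg_elt (p := (p + 1).succPNat) ha]; exact neg_mem ha'⟩ }
      have hle : Gam G (p + 1 + 1) ≤ H := by
        rw [Gam_succ_succ, Subgroup.commutator_le]
        intro x hx y _
        refine ⟨commutator_mem (q := 1) hx (mem_Gam_one y), ?_⟩
        have := hlie _ (ih x hx) _ (h1 y)
        erw [Gr.bracket_elt (q := 1) hx (mem_Gam_one y)] at this
        exact this
      exact fun g hg => (hle hg).2
  refine eq_top_iff.2 fun x _ => ?_
  induction x using Gr.induction with
  | h0 => exact zero_mem M
  | h1 p g hg =>
    obtain ⟨p, rfl⟩ : ∃ k : ℕ, p = k.succPNat := ⟨p.natPred, by simp⟩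
    exact key p g hg
  | h2 x y hx hy => exact add_mem (hx trivial) (hy trivial)

end DescendingCentral

/-! ### McCool's relations and surjectivity. -/

namespace McCool

open DescendingCentral

section Classes

variable {G : Type*} [Group G]

theorem of_cls₁_mul (g h : G) :
    Gr.of 1 (cls₁ (g * h)) = Gr.of 1 (cls₁ g) + Gr.of 1 (cls₁ h) :=
  (Gr.elt_add (p := 1) (mem_Gam_one g) (mem_Gam_one h)).symm

theorem lie_of_cls₁_eq_zero {g h : G} (hc : Commute g h) :
    ⁅Gr.of 1 (cls₁ g), Gr.of 1 (cls₁ h)⁆ = 0 := by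
  have := Gr.bracket_elt (p := 1) (q := 1) (mem_Gam_one g) (mem_Gam_one h)
  refine this.trans ?_
  rw [← Gr.elt_one (1 + 1)]
  exact Gr.elt_congr rfl _ _ (by rw [hc.commutator_eq])

end Classes

variable {n : ℕ}

theorem alpha_of (i j r : Fin n) : alpha i j (FreeGroup.of r) =
    if r = i then FreeGroup.of j * FreeGroup.of r * (FreeGroup.of j)⁻¹ else FreeGroup.of r := by
  split_ifs with h
  · subst h; exact alpha_of_self r j
  · exact alpha_of_ne h j

theorem mulAut_ext {f g : MulAut (FreeGroup (Fin n))}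
    (h : ∀ r, f (FreeGroup.of r) = g (FreeGroup.of r)) : f = g := by
  have : f.toMonoidHom = g.toMonoidHom := by
    ext r
    exact h r
  exact MulEquiv.ext fun x => DFunLike.congr_fun this x

/-- Each automorphism fixes both letters involved in the other, except for a possible common
conjugating letter, which both fix. -/
theorem alpha_commute {P K Q J : Fin n} (hKP : K < P) (hPQ : P < Q) (hJQ : J < Q) (hJP : J ≠ P) :
    Commute (alpha P K) (alpha Q J) := by
  refine mulAut_ext fun r => ?_
  have h1 := hKP.ne
  have h2 := hPQ.ne
  have h3 := hJQ.ne
  have h4 := (hKP.trans hPQ).ne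
  by_cases hP : r = P
  · subst hP
    simp [alpha_of, *]
  · by_cases hQ : r = Q
    · subst hQ
      simp [alpha_of, *]
    · simp [alpha_of, *]

/-- The product conjugates both `x_P` and `x_Q` by the fixed letter `x_K`, and this is compatible
with conjugating `x_Q` by `x_P`. -/
theorem alpha_mul_alpha_commute {P K Q : Fin n} (hKP : K < P) (hPQ : P < Q) :
    Commute (alpha Q K * alpha P K) (alpha Q P) := by
  refine mulAut_ext fun r => ?_
  have h1 := hKP.ne
  have h2 := hPQ.ne
  have h4 := (hKP.trans hPQ).ne
  by_cases hP : r = P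
  · subst hP
    simp [alpha_of, *]
  · by_cases hQ : r = Q
    · subst hQ
      simp [alpha_of, *]
      group
    · simp [alpha_of, *]

theorem gen_commute {p q : Idx n} (hpq : p < q) (k : Fin (p - 1)) (j : Fin (q - 1))
    (hj : (j : ℕ) ≠ p - 1) : Commute (gen p k) (gen q j) := by
  have hp := Finset.mem_Icc.1 p.2
  have hpq' : (p : ℕ) < q := hpq
  refine Subtype.ext (alpha_commute (n := n) ?_ ?_ ?_ ?_)
  · exact k.2
  · exact Fin.mk_lt_mk.2 (by omega)
  · exact j.2
  · exact fun e => hj (congrArg Fin.val e)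

theorem gen_mul_gen_commute {p q : Idx n} (hpq : p < q) (k : Fin (p - 1)) (k' j : Fin (q - 1))
    (hk : (k' : ℕ) = k) (hj : (j : ℕ) = p - 1) : Commute (gen q k' * gen p k) (gen q j) := by
  have hp := Finset.mem_Icc.1 p.2
  have hq := Finset.mem_Icc.1 q.2
  have hpq' : (p : ℕ) < q := hpq
  have h := alpha_mul_alpha_commute (n := n) (P := ⟨p - 1, by omega⟩) (K := ⟨k, by omega⟩)
    (Q := ⟨q - 1, by omega⟩) k.2 (Fin.mk_lt_mk.2 (by omega))
  refine Subtype.ext ?_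
  change alpha _ _ * alpha _ _ * alpha _ _ = alpha _ _ * (alpha _ _ * alpha _ _)
  simp only [hk, hj]
  exact h

/-- The Lie algebra map from the free Lie algebra given by the generators `α_{q,j}`. -/
noncomputable def genLie (q : Idx n) :
    FreeLieAlgebra ℤ (Fin (q - 1)) →ₗ⁅ℤ⁆ Gr (PSigmaPlus n) :=
  FreeLieAlgebra.lift ℤ fun j => Gr.of 1 (cls₁ (gen q j))

theorem genLie_of (q : Idx n) (j : Fin (q - 1)) :
    genLie q (FreeLieAlgebra.of ℤ j) = Gr.of 1 (cls₁ (gen q j)) :=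
  FreeLieAlgebra.lift_of_apply _ _

/-- Either the generators commute, or the second McCool relation gives `[α_{p,k}, α_{q,p}] =
-[α_{q,k}, α_{q,p}]` in the graded ring. -/
theorem gen_lie_gen_mem {p q : Idx n} (hpq : p < q) (k : Fin (p - 1)) (j : Fin (q - 1)) :
    ⁅Gr.of 1 (cls₁ (gen p k)), Gr.of 1 (cls₁ (gen q j))⁆ ∈ (genLie q).range := by
  have hpq' : (p : ℕ) < q := hpq
  by_cases hj : (j : ℕ) = p - 1
  · have h := lie_of_cls₁_eq_zero (gen_mul_gen_commute hpq k ⟨k, by omega⟩ j rfl hj)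
    rw [of_cls₁_mul, add_lie] at h
    rw [eq_neg_of_add_eq_zero_right h, ← genLie_of, ← genLie_of, ← LieHom.map_lie]
    exact neg_mem ⟨_, rfl⟩
  · rw [lie_of_cls₁_eq_zero (gen_commute hpq k j hj)]
    exact zero_mem _

/-- The Jacobi identity extends the case of generators, first in the second argument and then in the
first. -/
theorem lie_mem_range {p q : Idx n} (hpq : p < q) {x y : Gr (PSigmaPlus n)}
    (hx : x ∈ (genLie p).range) (hy : y ∈ (genLie q).range) : ⁅x, y⁆ ∈ (genLie q).range := by
  obtain ⟨u, rfl⟩ := (LieHom.mem_range _ _).1 hx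
  clear hx
  induction u using FreeLieEmbedding.freeLie_int_induction generalizing y with
  | of k =>
    rw [genLie_of]
    obtain ⟨v, rfl⟩ := (LieHom.mem_range _ _).1 hy
    clear hy
    induction v using FreeLieEmbedding.freeLie_int_induction with
    | of j => rw [genLie_of]; exact gen_lie_gen_mem hpq k j
    | zero => rw [map_zero, lie_zero]; exact zero_mem _
    | add a b ha hb => rw [map_add, lie_add]; exact add_mem ha hb
    | neg a ha => rw [map_neg, lie_neg]; exact neg_mem ha
    | lie a b ha hb =>
      rw [LieHom.map_lie, leibniz_lie]
      exact add_mem ((genLie q).range.lie_mem ha ⟨b, rfl⟩) ((genLie q).range.lie_mem ⟨a, rfl⟩ hb)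
  | zero => rw [map_zero, zero_lie]; exact zero_mem _
  | add a b ha hb => rw [map_add, add_lie]; exact add_mem (ha hy) (hb hy)
  | neg a ha => rw [map_neg, neg_lie]; exact neg_mem (ha hy)
  | lie a b ha hb =>
    rw [LieHom.map_lie, lie_lie]
    exact sub_mem (ha (hb hy)) (hb (ha hy))

/-- The sum of the Lie algebra maps given by the generators. -/
noncomputable def genSum (n : ℕ) :
    (⨁ q : Idx n, FreeLieAlgebra ℤ (Fin (q - 1))) →+ Gr (PSigmaPlus n) :=
  DirectSum.toAddMonoid fun q => (genLie q : _ →ₗ[ℤ] _).toAddMonoidHom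

theorem genSum_of (q : Idx n) (u : FreeLieAlgebra ℤ (Fin (q - 1))) :
    genSum n (DirectSum.of (fun q : Idx n => FreeLieAlgebra ℤ (Fin (q - 1))) q u) = genLie q u :=
  DirectSum.toAddMonoid_of _ _ _

theorem genSum_surjective (n : ℕ) : Function.Surjective (genSum n) := by
  rw [← AddMonoidHom.range_eq_top]
  have hmem : ∀ (q : Idx n) {x}, x ∈ (genLie q).range → x ∈ (genSum n).range := by
    rintro q _ ⟨u, rfl⟩
    exact ⟨_, genSum_of q u⟩
  refine eq_top_of_lie_mem _ ?_ ?_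
  · rintro _ ⟨a, rfl⟩ _ ⟨b, rfl⟩
    induction a using DirectSum.induction_on with
    | zero => simp
    | add a a' ha ha' => rw [map_add, add_lie]; exact add_mem ha ha'
    | of p u =>
      induction b using DirectSum.induction_on with
      | zero => simp
      | add b b' hb hb' => rw [map_add, lie_add]; exact add_mem hb hb'
      | of q v =>
        rw [genSum_of, genSum_of]
        rcases lt_trichotomy p q with h | rfl | h
        · exact hmem q (lie_mem_range h ⟨u, rfl⟩ ⟨v, rfl⟩)
        · exact hmem p ((genLie p).range.lie_mem ⟨u, rfl⟩ ⟨v, rfl⟩)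
        · rw [← lie_skew]
          exact neg_mem (hmem p (lie_mem_range h ⟨v, rfl⟩ ⟨u, rfl⟩))
  · rintro ⟨g, hg⟩
    induction hg using Subgroup.closure_induction with
    | mem g h =>
      obtain ⟨i, j, hji, rfl⟩ := h
      have hi := i.2
      have hji' : (j : ℕ) < i := hji
      -- Indices in `Fin n` start at 0, so `i` stands for `x_{i+1}`; `j < i` gives `q ≥ 2`.
      let q : Idx n := ⟨i + 1, Finset.mem_Icc.2 (by omega)⟩
      exact hmem q ⟨FreeLieAlgebra.of ℤ ⟨j, hji⟩, genLie_of q ⟨j, hji⟩⟩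
    | one =>
      have h := of_cls₁_mul (1 : PSigmaPlus n) 1
      rw [mul_one, left_eq_add] at h
      have : Gr.of 1 (cls₁ (1 : PSigmaPlus n)) ∈ (genSum n).range := by rw [h]; exact zero_mem _
      exact this
    | mul g h hg hh ihg ihh =>
      have := of_cls₁_mul (⟨g, hg⟩ : PSigmaPlus n) ⟨h, hh⟩
      exact this ▸ add_mem ihg ihh
    | inv g hg ih =>
      have := Gr.neg_elt (p := 1) (mem_Gam_one (⟨g, hg⟩ : PSigmaPlus n))
      exact (congrArg (· ∈ (genSum n).range) this).mp (neg_mem ih)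

end McCool

/-! ### Injectivity, by the Johnson homomorphism -/

namespace McCool

open DescendingCentral FreeLieEmbedding

variable {n : ℕ}

/-- The generator `x_q` of the free algebra. -/
noncomputable def topVar (q : Idx n) : FreeAlgebra ℤ (Fin n) :=
  FreeAlgebra.ι ℤ ⟨q - 1, by have := Finset.mem_Icc.1 q.2; omega⟩

/-- The anti-homomorphism `x_j ↦ x_j` from the free algebra on the first `q - 1` generators. -/
noncomputable def revHom (q : Idx n) :
    FreeAlgebra ℤ (Fin (q - 1)) →ₐ[ℤ] (FreeAlgebra ℤ (Fin n))ᵐᵒᵖ :=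
  FreeAlgebra.lift ℤ fun j =>
    MulOpposite.op (FreeAlgebra.ι ℤ ⟨j, by have := Finset.mem_Icc.1 q.2; omega⟩)

/-- A Lie element on the first `q - 1` generators, reversed. -/
noncomputable def revElt (q : Idx n) (u : FreeLieAlgebra ℤ (Fin (q - 1))) :
    FreeAlgebra ℤ (Fin n) :=
  (revHom q (toFreeAlgebra ℤ _ u)).unop

theorem revElt_of (q : Idx n) (j : Fin (q - 1)) : revElt q (FreeLieAlgebra.of ℤ j) =
    FreeAlgebra.ι ℤ ⟨j, by have := Finset.mem_Icc.1 q.2; omega⟩ := by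
  simp [revElt, revHom]

theorem revElt_lie (q : Idx n) (u v : FreeLieAlgebra ℤ (Fin (q - 1))) :
    revElt q ⁅u, v⁆ = revElt q v * revElt q u - revElt q u * revElt q v := by
  simp [revElt, LieRing.of_associative_ring_bracket]

/-- `D` is the derivation that sends `x_q` to `[W, x_q]` and kills the other generators. -/
structure IsConjDerivation (q : Idx n) (W : FreeAlgebra ℤ (Fin n))
    (D : Module.End ℤ (FreeAlgebra ℤ (Fin n))) : Prop where
  leibniz : ∀ a b, D (a * b) = D a * b + a * D b
  apply_top : D (topVar q) = W * topVar q - topVar q * W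
  apply_ne : ∀ x : Fin n, (x : ℕ) ≠ q - 1 → D (FreeAlgebra.ι ℤ x) = 0

theorem IsConjDerivation.apply_rev {q : Idx n} {W : FreeAlgebra ℤ (Fin n)}
    {D : Module.End ℤ (FreeAlgebra ℤ (Fin n))} (h : IsConjDerivation q W D)
    (a : FreeAlgebra ℤ (Fin (q - 1))) : D (revHom q a).unop = 0 := by
  have h1 : D 1 = 0 := by simpa using h.leibniz 1 1
  induction a using FreeAlgebra.induction with
  | grade0 r =>
    rw [AlgHom.commutes, MulOpposite.algebraMap_apply, MulOpposite.unop_op,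
      Algebra.algebraMap_eq_smul_one, map_smul, h1, smul_zero]
  | grade1 j =>
    rw [revHom, FreeAlgebra.lift_ι_apply, MulOpposite.unop_op]
    exact h.apply_ne _ (ne_of_lt j.2)
  | mul a b ha hb => rw [map_mul, MulOpposite.unop_mul, h.leibniz, ha, hb]; simp
  | add a b ha hb => rw [map_add, MulOpposite.unop_add, map_add, ha, hb, add_zero]

/-- If `D_a x_q = [W_a, x_q]`, `D_b x_q = [W_b, x_q]` and both derivations kill `W_a` and `W_b`,
then `[D_a, D_b] x_q = [[W_b, W_a], x_q]`. The order is reversed, which is why `revHom` is an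
anti-homomorphism. -/
theorem isConjDerivation_genLie (q : Idx n) (u : FreeLieAlgebra ℤ (Fin (q - 1))) :
    IsConjDerivation q (revElt q u) (johnson n (genLie q u)) := by
  induction u using freeLie_int_induction with
  | zero => constructor <;> simp [revElt]
  | of j =>
    rw [genLie_of, johnson_gen, revElt_of]
    refine ⟨freeDerivation_mul _, ?_, fun x hx => ?_⟩
    · exact (freeDerivation_ι _ _).trans (if_pos rfl)
    · exact (freeDerivation_ι _ _).trans (if_neg hx)
  | add a b ha hb =>
    have e : revElt q (a + b) = revElt q a + revElt q b := by simp [revElt]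
    rw [map_add, map_add, e]
    refine ⟨fun x y => ?_, ?_, fun x hx => ?_⟩
    · simp only [LinearMap.add_apply, ha.leibniz, hb.leibniz]; noncomm_ring
    · simp only [LinearMap.add_apply, ha.apply_top, hb.apply_top]; noncomm_ring
    · simp only [LinearMap.add_apply, ha.apply_ne x hx, hb.apply_ne x hx, add_zero]
  | neg a ha =>
    have e : revElt q (-a) = -revElt q a := by simp [revElt]
    rw [map_neg, map_neg, e]
    refine ⟨fun x y => ?_, ?_, fun x hx => ?_⟩
    · simp only [LinearMap.neg_apply, ha.leibniz]; noncomm_ring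
    · simp only [LinearMap.neg_apply, ha.apply_top]; noncomm_ring
    · simp only [LinearMap.neg_apply, ha.apply_ne x hx, neg_zero]
  | lie a b ha hb =>
    have hab : ∀ z, johnson n (genLie q ⁅a, b⁆) z =
        johnson n (genLie q a) (johnson n (genLie q b) z) -
          johnson n (genLie q b) (johnson n (genLie q a) z) := by
      intro z
      rw [LieHom.map_lie, johnson, lead_lie]
      rfl
    have hb0 : johnson n (genLie q a) (revElt q b) = 0 := ha.apply_rev _
    have ha0 : johnson n (genLie q b) (revElt q a) = 0 := hb.apply_rev _
    refine ⟨fun x y => ?_, ?_, fun x hx => ?_⟩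
    · simp only [hab, ha.leibniz, hb.leibniz, map_add]; noncomm_ring
    · rw [hab, revElt_lie]
      simp only [hb.apply_top, ha.apply_top, map_sub, ha.leibniz, hb.leibniz, ha0, hb0]
      noncomm_ring
    · rw [hab, ha.apply_ne x hx, hb.apply_ne x hx, map_zero, map_zero, sub_zero]

/-! ### Lie elements commuting with `x_q` vanish. -/

section Matrix

variable (q : Idx n)

/-- A representation of the free algebra by matrices that separates the Lie elements from the
commutators with `x_q`. -/
noncomputable def matrixHom : FreeAlgebra ℤ (Fin n) →ₐ[ℤ]
    Matrix (Fin 2) (Fin 2) (FreeAlgebra ℤ (Fin (q - 1)))ᵐᵒᵖ :=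
  FreeAlgebra.lift ℤ fun x =>
    if h : (x : ℕ) < q - 1 then !![MulOpposite.op (FreeAlgebra.ι ℤ ⟨x, h⟩), 0; 0, 0]
    else !![0, 1; 0, 0]

theorem matrixHom_topVar : matrixHom q (topVar q) = !![0, 1; 0, 0] := by
  rw [matrixHom, topVar, FreeAlgebra.lift_ι_apply, dif_neg (lt_irrefl _)]

/-- The opposite coefficient ring undoes the reversal, so the upper left entry recovers `a`; the
lower right entry retains only the constant term. -/
theorem matrixHom_revHom (a : FreeAlgebra ℤ (Fin (q - 1))) :
    matrixHom q (revHom q a).unop = !![MulOpposite.op a, 0; 0,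
      algebraMap ℤ _ (FreeAlgebra.algebraMapInv a)] := by
  induction a using FreeAlgebra.induction with
  | grade0 r =>
    rw [AlgHom.commutes, MulOpposite.algebraMap_apply, MulOpposite.unop_op, AlgHom.commutes,
      FreeAlgebra.algebraMap_leftInverse]
    ext i j
    fin_cases i <;> fin_cases j <;> simp [Matrix.algebraMap_matrix_apply]
  | grade1 j =>
    rw [revHom, FreeAlgebra.lift_ι_apply, MulOpposite.unop_op, matrixHom, FreeAlgebra.lift_ι_apply,
      dif_pos j.2]
    simp [FreeAlgebra.algebraMapInv]
  | mul a b ha hb =>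
    have e : algebraMap ℤ (FreeAlgebra ℤ (Fin (q - 1)))ᵐᵒᵖ (FreeAlgebra.algebraMapInv (a * b)) =
        algebraMap ℤ _ (FreeAlgebra.algebraMapInv b) *
          algebraMap ℤ _ (FreeAlgebra.algebraMapInv a) := by
      rw [map_mul, mul_comm, map_mul]
    rw [map_mul, MulOpposite.unop_mul, map_mul, ha, hb, Matrix.mul_fin_two, e, MulOpposite.op_mul]
    simp
  | add a b ha hb =>
    rw [map_add, MulOpposite.unop_add, map_add, ha, hb]
    ext i j
    fin_cases i <;> fin_cases j <;> simp

theorem algebraMapInv_toFreeAlgebra {X : Type*} (u : FreeLieAlgebra ℤ X) :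
    FreeAlgebra.algebraMapInv (toFreeAlgebra ℤ X u) = 0 := by
  induction u using freeLie_int_induction with
  | zero => simp
  | of x => simp [FreeAlgebra.algebraMapInv]
  | add a b ha hb => rw [map_add, map_add, ha, hb, add_zero]
  | neg a ha => rw [map_neg, map_neg, ha, neg_zero]
  | lie a b ha hb => simp [LieRing.of_associative_ring_bracket, ha, hb]

variable {q} in
-- Lie elements have no constant term, so the upper right entry of the image of `[W, x_q]` is the
-- Lie element itself.
theorem eq_zero_of_commute {u : FreeLieAlgebra ℤ (Fin (q - 1))}
    (h : revElt q u * topVar q - topVar q * revElt q u = 0) : u = 0 := by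
  have h1 := congrArg (fun M => matrixHom q M 0 1) h
  simp only [map_sub, map_mul, revElt, matrixHom_revHom, matrixHom_topVar,
    algebraMapInv_toFreeAlgebra, map_zero, Matrix.mul_fin_two] at h1
  apply toFreeAlgebra_injective
  simpa using h1

end Matrix

/-- Derivations from the summands `p ≠ q` kill `x_q`, so all summands are separated at once. -/
theorem johnson_genSum (z : ⨁ q : Idx n, FreeLieAlgebra ℤ (Fin (q - 1))) (q : Idx n) :
    johnson n (genSum n z) (topVar q) =
      revElt q (z q) * topVar q - topVar q * revElt q (z q) := by
  induction z using DirectSum.induction_on with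
  | zero => simp [revElt]
  | add a b ha hb =>
    rw [map_add, map_add, LinearMap.add_apply, ha, hb, DirectSum.add_apply]
    simp only [revElt, map_add, MulOpposite.unop_add]
    noncomm_ring
  | of p u =>
    rw [genSum_of]
    by_cases h : p = q
    · subst h
      rw [DirectSum.of_eq_same]
      exact (isConjDerivation_genLie p u).apply_top
    · rw [DirectSum.of_eq_of_ne _ _ _ (Ne.symm h)]
      have hp := Finset.mem_Icc.1 p.2
      have hq := Finset.mem_Icc.1 q.2
      have hpq : (p : ℕ) ≠ q := fun e => h (Subtype.ext e)
      have := (isConjDerivation_genLie p u).apply_ne ⟨q - 1, by omega⟩ (by simp only; omega)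
      rw [topVar, this]
      simp [revElt]

theorem genSum_injective (n : ℕ) : Function.Injective (genSum n) := by
  refine (injective_iff_map_eq_zero _).2 fun z hz => ?_
  ext q : 1
  refine eq_zero_of_commute (q := q) ?_
  rw [← johnson_genSum, hz, map_zero, LinearMap.zero_apply]

/-- The additive isomorphism from the sum of the free Lie algebras to the associated graded. -/
noncomputable def genEquiv (n : ℕ) :
    (⨁ q : Idx n, FreeLieAlgebra ℤ (Fin (q - 1))) ≃+ Gr (PSigmaPlus n) :=
  AddEquiv.ofBijective (genSum n) ⟨genSum_injective n, genSum_surjective n⟩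

end McCool

/-! ### Abelianization and homogeneous components. -/

namespace DescendingCentral

variable {G : Type*} [Group G]

theorem Gam_two_le_ker : Gam G 2 ≤ (Abelianization.of (G := G)).ker := by
  rw [Gam_succ_succ 0, Subgroup.commutator_le]
  intro x _ y _
  rw [MonoidHom.mem_ker, map_commutatorElement, commutatorElement_eq_one_iff_mul_comm, mul_comm]

/-- `gr_1(G)` is the abelianization of `G`. -/
def grOneEquiv (G : Type*) [Group G] : GrMul G 1 ≃* Abelianization G :=
  MonoidHom.toMulEquiv
    (QuotientGroup.lift _ (Abelianization.of.comp (Gam G 1).subtype) fun x hx =>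
      Gam_two_le_ker (Subgroup.mem_subgroupOf.1 hx))
    (Abelianization.lift (MonoidHom.mk' (fun x => QuotientGroup.mk ⟨x, mem_Gam_one x⟩)
      fun _ _ => rfl))
    (by ext x; rfl)
    (by ext x; rfl)

namespace Gr

/-- The component of degree `p`. -/
noncomputable def component (p : ℕ+) : Gr G →+ GrPiece G p :=
  DFinsupp.evalAddMonoidHom p

theorem component_of (p : ℕ+) (y : GrPiece G p) : component p (of p y) = y :=
  DirectSum.of_eq_same (β := fun p : ℕ+ => GrPiece G p) p y

theorem component_of_ne {p q : ℕ+} (h : p ≠ q) (y : GrPiece G p) : component q (of p y) = 0 :=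
  DirectSum.of_eq_of_ne (β := fun p : ℕ+ => GrPiece G p) p q y h.symm

end Gr

end DescendingCentral

/-! ### Transfer to `L[V_{q-1}]` and restriction to each degree. -/

namespace McCool

open DescendingCentral FreeLieEmbedding FreeLie

variable {n : ℕ}

/-- The Lie algebra map `L[V_{q-1}] → gr_*(PΣ_n⁺)` that sends `e_j` to the class of `α_{q,j}`. -/
noncomputable def fiberLie (q : Idx n) : freeLie (FreeAb (q - 1)) →ₗ⁅ℤ⁆ Gr (PSigmaPlus n) :=
  (genLie q).comp (equivFreeLie (q - 1)).symm.toLieHom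

theorem fiberLie_toFreeLie (q : Idx n) (u : FreeLieAlgebra ℤ (Fin (q - 1))) :
    fiberLie q (toFreeLie _ u) = genLie q u :=
  congrArg (genLie q) ((equivFreeLie (q - 1)).symm_apply_apply u)

theorem fiberLie_inj (q : Idx n) (j : Fin (q - 1)) :
    fiberLie q (inj (Pi.single j 1)) = Gr.of 1 (cls₁ (gen q j)) := by
  rw [← toFreeLie_of, fiberLie_toFreeLie, genLie_of]

/-- The identification of the sums of the two models of the free Lie algebras. -/
noncomputable def sumEquiv (n : ℕ) : (⨁ q : Idx n, freeLie (FreeAb (q - 1))) ≃+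
    ⨁ q : Idx n, FreeLieAlgebra ℤ (Fin (q - 1)) :=
  DFinsupp.mapRange.addEquiv fun q : Idx n =>
    (equivFreeLie (q - 1)).symm.toLinearEquiv.toAddEquiv

theorem sumEquiv_of (q : Idx n) (x : freeLie (FreeAb (q - 1))) :
    sumEquiv n (DirectSum.of (fun q : Idx n => freeLie (FreeAb (q - 1))) q x) =
      DirectSum.of (fun q : Idx n => FreeLieAlgebra ℤ (Fin (q - 1))) q
        ((equivFreeLie (q - 1)).symm x) :=
  DFinsupp.mapRange_single (hf := fun _ => map_zero _)

/-- The sum of the maps `fiberLie q`. -/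
noncomputable def fiberEquiv (n : ℕ) :
    (⨁ q : Idx n, freeLie (FreeAb (q - 1))) ≃+ Gr (PSigmaPlus n) :=
  (sumEquiv n).trans (genEquiv n)

theorem fiberEquiv_of (q : Idx n) (x : freeLie (FreeAb (q - 1))) :
    fiberEquiv n (DirectSum.of (fun q : Idx n => freeLie (FreeAb (q - 1))) q x) =
      fiberLie q x :=
  (congrArg (genSum n) (sumEquiv_of q x)).trans (genSum_of q _)

theorem fiberLie_injective (q : Idx n) : Function.Injective (fiberLie q) := by
  intro x y h
  rw [← fiberEquiv_of, ← fiberEquiv_of] at h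
  exact DirectSum.of_injective q ((fiberEquiv n).injective h)

theorem inj_mem_freeLiePart {V : Type*} [AddCommGroup V] (v : V) :
    inj v ∈ freeLiePart V ((1 : ℕ+) : ℕ) := by
  change TensorAlgebra.ι ℤ v ∈ (TensorAlgebra.ι ℤ : V →ₗ[ℤ] TensorAlgebra ℤ V).range ^ 1
  rw [pow_one]
  exact ⟨v, rfl⟩

section Grading

variable (q : Idx n)

/-- The homogeneous elements of degree `s` whose image is homogeneous of degree `s`. -/
noncomputable def homogeneousPart (s : ℕ+) : AddSubgroup (freeLie (FreeAb (q - 1))) :=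
  (freeLiePart (FreeAb (q - 1)) s).toAddSubgroup ⊓
    (Gr.of s).range.comap (fiberLie q : _ →ₗ[ℤ] Gr (PSigmaPlus n)).toAddMonoidHom

variable {q}

theorem lie_mem_homogeneousPart {s t : ℕ+} {x y : freeLie (FreeAb (q - 1))}
    (hx : x ∈ homogeneousPart q s) (hy : y ∈ homogeneousPart q t) :
    ⁅x, y⁆ ∈ homogeneousPart q (s + t) := by
  obtain ⟨hx, a, ha⟩ := hx
  obtain ⟨hy, b, hb⟩ := hy
  refine ⟨?_, brPos s t a b, ?_⟩
  · have h1 := Submodule.mul_mem_mul hx hy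
    have h2 := Submodule.mul_mem_mul hy hx
    rw [← pow_add] at h1 h2
    rw [add_comm] at h2
    exact sub_mem h1 h2
  · rw [← Gr.bracket_of_of, ha, hb]
    exact ((fiberLie q).map_lie x y).symm

/-- Generators have degree 1 on both sides, and brackets add degrees on both sides. -/
theorem mem_iSup_homogeneousPart (z : freeLie (FreeAb (q - 1))) :
    z ∈ ⨆ s, homogeneousPart q s := by
  obtain ⟨u, rfl⟩ := toFreeLie_surjective _ z
  induction u using freeLie_int_induction with
  | zero => rw [map_zero]; exact zero_mem _
  | of j =>
    refine AddSubgroup.mem_iSup_of_mem 1 ⟨?_, cls₁ (gen q j), ?_⟩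
    · rw [toFreeLie_of]
      exact inj_mem_freeLiePart _
    · rw [← genLie_of, ← fiberLie_toFreeLie]
      rfl
  | add a b ha hb => rw [map_add]; exact add_mem ha hb
  | neg a ha => rw [map_neg]; exact neg_mem ha
  | lie a b ha hb =>
    rw [LieHom.map_lie]
    refine AddSubgroup.iSup_induction (homogeneousPart q)
      (C := fun x => ⁅x, toFreeLie _ b⁆ ∈ ⨆ s, homogeneousPart q s) ha (fun s x hx => ?_) ?_
      fun x x' hx hx' => ?_
    · refine AddSubgroup.iSup_induction (homogeneousPart q)
        (C := fun y => ⁅x, y⁆ ∈ ⨆ s, homogeneousPart q s) hb (fun t y hy => ?_) ?_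
        fun y y' hy hy' => ?_
      · exact AddSubgroup.mem_iSup_of_mem _ (lie_mem_homogeneousPart hx hy)
      · rw [lie_zero]; exact zero_mem _
      · rw [lie_add]; exact add_mem hy hy'
    · rw [zero_lie]; exact zero_mem _
    · rw [add_lie]; exact add_mem hx hx'

theorem homogeneousPart_induction {C : freeLie (FreeAb (q - 1)) → Prop}
    (mem : ∀ s, ∀ x ∈ homogeneousPart q s, C x) (zero : C 0)
    (add : ∀ x y, C x → C y → C (x + y)) (z : freeLie (FreeAb (q - 1))) : C z :=
  AddSubgroup.iSup_induction (C := C) (homogeneousPart q) (mem_iSup_homogeneousPart z) mem zero add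

/-- The degree `s` component of the tensor algebra. -/
noncomputable def tensorComponent (V : Type*) [AddCommGroup V] (s : ℕ) (x : TensorAlgebra ℤ V) :
    TensorAlgebra ℤ V :=
  DirectSum.decompose
    (fun s : ℕ => (TensorAlgebra.ι ℤ : V →ₗ[ℤ] TensorAlgebra ℤ V).range ^ s) x s

theorem tensorComponent_of_mem {V : Type*} [AddCommGroup V] {s : ℕ} {x : freeLie V}
    (hx : x ∈ freeLiePart V s) : tensorComponent V s x = x :=
  DirectSum.decompose_of_mem_same
    (fun s : ℕ => (TensorAlgebra.ι ℤ : V →ₗ[ℤ] TensorAlgebra ℤ V).range ^ s) hx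

theorem tensorComponent_of_mem_ne {V : Type*} [AddCommGroup V] {s t : ℕ} {x : freeLie V}
    (hx : x ∈ freeLiePart V s) (h : s ≠ t) : tensorComponent V t x = 0 :=
  DirectSum.decompose_of_mem_ne
    (fun s : ℕ => (TensorAlgebra.ι ℤ : V →ₗ[ℤ] TensorAlgebra ℤ V).range ^ s) hx h

theorem tensorComponent_add {V : Type*} [AddCommGroup V] (s : ℕ) (x y : TensorAlgebra ℤ V) :
    tensorComponent V s (x + y) = tensorComponent V s x + tensorComponent V s y := by
  simp [tensorComponent, DirectSum.decompose_add]

theorem exists_mem_homogeneousPart (z : freeLie (FreeAb (q - 1))) (t : ℕ+) :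
    ∃ w ∈ homogeneousPart q t, (w : TensorAlgebra ℤ (FreeAb (q - 1))) =
      tensorComponent (FreeAb (q - 1)) t z := by
  induction z using homogeneousPart_induction with
  | mem s x hx =>
    by_cases h : s = t
    · subst h
      exact ⟨x, hx, (tensorComponent_of_mem hx.1).symm⟩
    · exact ⟨0, zero_mem _, (tensorComponent_of_mem_ne hx.1 fun e => h (PNat.eq e)).symm⟩
  | zero => exact ⟨0, zero_mem _, by simp [tensorComponent]⟩
  | add x y hx hy =>
    obtain ⟨v, hv, ev⟩ := hx
    obtain ⟨w, hw, ew⟩ := hy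
    refine ⟨v + w, add_mem hv hw, ?_⟩
    refine (congrArg₂ (· + ·) ev ew).trans (tensorComponent_add _ _ _).symm

/-- A homogeneous element is its own tensor component, and components of sums of doubly homogeneous
elements are doubly homogeneous. Hence `fiberLie` preserves degree. -/
theorem mem_homogeneousPart {s : ℕ+} {z : freeLie (FreeAb (q - 1))}
    (hz : z ∈ freeLiePart (FreeAb (q - 1)) s) : z ∈ homogeneousPart q s := by
  obtain ⟨w, hw, e⟩ := exists_mem_homogeneousPart z s
  rw [tensorComponent_of_mem hz] at e
  rwa [← Subtype.ext e]

variable (q)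

/-- The degree `s` part of `fiberLie q`. -/
noncomputable def fiberPart (s : ℕ+) :
    freeLiePart (FreeAb (q - 1)) s →+ GrPiece (PSigmaPlus n) s :=
  ((Gr.component s).comp (fiberLie q : _ →ₗ[ℤ] Gr (PSigmaPlus n)).toAddMonoidHom).comp
    (freeLiePart (FreeAb (q - 1)) s).subtype.toAddMonoidHom

theorem of_fiberPart (s : ℕ+) (x : freeLiePart (FreeAb (q - 1)) s) :
    Gr.of s (fiberPart q s x) = fiberLie q x := by
  obtain ⟨-, y, hy⟩ := mem_homogeneousPart x.2
  change Gr.of s (Gr.component s (fiberLie q x)) = _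
  change Gr.of s y = fiberLie q x at hy
  rw [← hy, Gr.component_of]

end Grading

/-- The sum of the maps `fiberPart q s`. -/
noncomputable def fiberPartSum (n : ℕ) (s : ℕ+) :
    (⨁ q : Idx n, freeLiePart (FreeAb (q - 1)) s) →+ GrPiece (PSigmaPlus n) s :=
  DirectSum.toAddMonoid fun q => fiberPart q s

theorem fiberPartSum_of (s : ℕ+) (q : Idx n) (x : freeLiePart (FreeAb (q - 1)) s) :
    fiberPartSum n s (DirectSum.of (fun q : Idx n => freeLiePart (FreeAb (q - 1)) s) q x) =
      fiberPart q s x :=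
  DirectSum.toAddMonoid_of _ _ _

theorem of_fiberPartSum (s : ℕ+) (z : ⨁ q : Idx n, freeLiePart (FreeAb (q - 1)) s) :
    Gr.of s (fiberPartSum n s z) = fiberEquiv n (DirectSum.map
      (fun q : Idx n => (freeLiePart (FreeAb (q - 1)) s).subtype.toAddMonoidHom) z) := by
  induction z using DirectSum.induction_on with
  | zero => simp
  | add a b ha hb => simp only [map_add, ha, hb]
  | of q x =>
    rw [fiberPartSum_of, of_fiberPart, DirectSum.map_of, fiberEquiv_of]
    rfl

theorem fiberPartSum_injective (n : ℕ) (s : ℕ+) : Function.Injective (fiberPartSum n s) := by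
  intro a b h
  have h1 := congrArg (Gr.of s) h
  rw [of_fiberPartSum, of_fiberPartSum] at h1
  exact (DirectSum.map_injective _).2 (fun q => Subtype.val_injective) ((fiberEquiv n).injective h1)

theorem component_fiberLie_mem (s : ℕ+) (q : Idx n) (x : freeLie (FreeAb (q - 1))) :
    Gr.component s (fiberLie q x) ∈ (fiberPartSum n s).range := by
  induction x using homogeneousPart_induction with
  | mem t x hx =>
    by_cases h : t = s
    · subst h
      exact ⟨_, fiberPartSum_of t q ⟨x, hx.1⟩⟩
    · obtain ⟨-, y, hy⟩ := hx
      change Gr.of t y = fiberLie q x at hy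
      rw [← hy, Gr.component_of_ne h]
      exact zero_mem _
  | zero => simp
  | add x y hx hy => rw [map_add, map_add]; exact add_mem hx hy

/-- Lift a homogeneous class through `fiberEquiv` and keep the degree `s` part of the lift; the
other degrees do not contribute. -/
theorem fiberPartSum_surjective (n : ℕ) (s : ℕ+) : Function.Surjective (fiberPartSum n s) := by
  intro y
  obtain ⟨z, hz⟩ := (fiberEquiv n).surjective (Gr.of s y)
  rw [← AddMonoidHom.mem_range, ← Gr.component_of s y, ← hz]
  clear hz
  induction z using DirectSum.induction_on with
  | zero => simp
  | add a b ha hb => rw [map_add, map_add]; exact add_mem ha hb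
  | of q x => rw [fiberEquiv_of]; exact component_fiberLie_mem s q x

/-- The degree `s` part of the additive isomorphism `fiberEquiv n`. -/
noncomputable def fiberPartEquiv (n : ℕ) (s : ℕ+) :
    (⨁ q : Idx n, freeLiePart (FreeAb (q - 1)) s) ≃+ GrPiece (PSigmaPlus n) s :=
  AddEquiv.ofBijective (fiberPartSum n s) ⟨fiberPartSum_injective n s, fiberPartSum_surjective n s⟩

/-- The map from `V` to the degree `1` part of `L[V]`. -/
noncomputable def toPartOne (V : Type*) [AddCommGroup V] : V →+ freeLiePart V ((1 : ℕ+) : ℕ) :=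
  AddMonoidHom.mk' (fun v => ⟨inj v, inj_mem_freeLiePart v⟩)
    fun v w => Subtype.ext (Subtype.ext (map_add (TensorAlgebra.ι ℤ) v w))

theorem toPartOne_bijective (V : Type*) [AddCommGroup V] : Function.Bijective (toPartOne V) := by
  constructor
  · intro v w h
    exact (TensorAlgebra.ι_inj ℤ v w).1
      (congrArg (fun x : freeLiePart V 1 => ((x : freeLie V) : TensorAlgebra ℤ V)) h)
  · rintro ⟨⟨x, hx⟩, hx'⟩
    change x ∈ (TensorAlgebra.ι ℤ : V →ₗ[ℤ] TensorAlgebra ℤ V).range ^ 1 at hx'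
    rw [pow_one] at hx'
    obtain ⟨v, rfl⟩ := hx'
    exact ⟨v, rfl⟩

/-- The sum of the groups `V_{q-1}` is the sum of the degree `1` parts. -/
noncomputable def sumPartOneEquiv (n : ℕ) : (⨁ q : Idx n, FreeAb (q - 1)) ≃+
    ⨁ q : Idx n, freeLiePart (FreeAb (q - 1)) ((1 : ℕ+) : ℕ) :=
  DFinsupp.mapRange.addEquiv fun q : Idx n =>
    AddEquiv.ofBijective (toPartOne (FreeAb (q - 1))) (toPartOne_bijective _)

theorem sumPartOneEquiv_of (q : Idx n) (v : FreeAb (q - 1)) :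
    sumPartOneEquiv n (DirectSum.of (fun q : Idx n => FreeAb (q - 1)) q v) =
      DirectSum.of (fun q : Idx n => freeLiePart (FreeAb (q - 1)) ((1 : ℕ+) : ℕ)) q
        (toPartOne _ v) :=
  DFinsupp.mapRange_single (hf := fun _ => map_zero _)

theorem fiberPart_toPartOne (q : Idx n) (j : Fin (q - 1)) :
    fiberPart q 1 (toPartOne _ (Pi.single j 1)) = cls₁ (gen q j) :=
  (congrArg (Gr.component 1) (fiberLie_inj q j)).trans (Gr.component_of 1 _)

/-! ### Failure of compatibility with brackets. -/

theorem lie_of_ne_zero {X : Type*} {x y : X} (h : x ≠ y) :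
    ⁅FreeLieAlgebra.of ℤ x, FreeLieAlgebra.of ℤ y⁆ ≠ 0 := by
  classical
  intro h0
  let f : FreeAlgebra ℤ X →ₐ[ℤ] Matrix (Fin 2) (Fin 2) ℤ :=
    FreeAlgebra.lift ℤ fun z => if z = x then !![0, 1; 0, 0] else !![0, 0; 1, 0]
  have h1 := congrArg (fun u => f (toFreeAlgebra ℤ X u) 0 0) h0
  simp [LieRing.of_associative_ring_bracket, f, h.symm] at h1

/-- By the McCool relation the bracket is `-[α_{q,k}, α_{q,p}]`, the image under the injective
`fiberLie q` of a bracket of two distinct letters, up to sign. -/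
theorem lie_gen_ne_zero {p q : Idx n} (hpq : p < q) (k : Fin (p - 1)) (j : Fin (q - 1))
    (hj : (j : ℕ) = p - 1) :
    ⁅Gr.of 1 (cls₁ (gen p k)), Gr.of 1 (cls₁ (gen q j))⁆ ≠ 0 := by
  have hpq' : (p : ℕ) < q := hpq
  intro h0
  have h := lie_of_cls₁_eq_zero (gen_mul_gen_commute hpq k ⟨k, by omega⟩ j rfl hj)
  rw [of_cls₁_mul, add_lie, h0, add_zero, ← fiberLie_inj, ← fiberLie_inj, ← LieHom.map_lie,
    ← toFreeLie_of, ← toFreeLie_of, ← LieHom.map_lie] at h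
  refine lie_of_ne_zero (fun e => ?_) (toFreeLie_injective _
    ((fiberLie_injective q (h.trans (map_zero _).symm)).trans (map_zero _).symm))
  have := congrArg Fin.val e
  simp only at this
  omega

end McCool

theorem mainTheorem6 (n : ℕ) :
    -- degreewise additive isomorphisms for `s ≥ 2`
    (∀ s : ℕ, 2 ≤ s →
      Nonempty ((⨁ q : McCool.Idx n, FreeLie.freeLiePart (FreeAb (q - 1)) s) ≃+
        DescendingCentral.GrPiece (McCool.PSigmaPlus n) s)) ∧
    -- each `L[V_{q-1}]` is a Lie subalgebra of `gr_*(PΣ_n⁺)`, and the sum of the inclusions is an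
    -- additive isomorphism that restricts to the graded pieces
    (∃ (φ : ∀ q : McCool.Idx n, FreeLie.freeLie (FreeAb (q - 1)) →ₗ⁅ℤ⁆
          DescendingCentral.Gr (McCool.PSigmaPlus n))
        (Φ : (⨁ q : McCool.Idx n, FreeLie.freeLie (FreeAb (q - 1))) ≃+
          DescendingCentral.Gr (McCool.PSigmaPlus n))
        (ψ : ∀ s : ℕ+, (⨁ q : McCool.Idx n, FreeLie.freeLiePart (FreeAb (q - 1)) s) ≃+
          DescendingCentral.GrPiece (McCool.PSigmaPlus n) s),
      (∀ q, Function.Injective (φ q)) ∧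
      (∀ (q : McCool.Idx n) (j : Fin (q - 1)),
        φ q (FreeLie.inj (Pi.single j 1)) =
          DescendingCentral.Gr.of 1 (McCool.cls₁ (McCool.gen q j))) ∧
      (∀ (q : McCool.Idx n) (x : FreeLie.freeLie (FreeAb (q - 1))),
        Φ (DirectSum.of (fun q : McCool.Idx n => FreeLie.freeLie (FreeAb (q - 1))) q x) = φ q x) ∧
      (∀ (s : ℕ+) (q : McCool.Idx n) (x : FreeLie.freeLiePart (FreeAb (q - 1)) s),
        DescendingCentral.Gr.of s (ψ s (DirectSum.of
          (fun q : McCool.Idx n => FreeLie.freeLiePart (FreeAb (q - 1)) s) q x)) = φ q x) ∧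
      -- the additive isomorphism is not an isomorphism of Lie algebras
      (3 ≤ n → ∃ x y, Φ ⁅x, y⁆ ≠ ⁅Φ x, Φ y⁆)) ∧
    -- the case `s = 1`
    (∃ (θ : (⨁ q : McCool.Idx n, FreeAb (q - 1)) ≃+
          DescendingCentral.GrPiece (McCool.PSigmaPlus n) 1)
        (κ : DescendingCentral.GrPiece (McCool.PSigmaPlus n) 1 ≃+
          Additive (Abelianization (McCool.PSigmaPlus n))),
      (∀ (q : McCool.Idx n) (j : Fin (q - 1)),
        θ (DirectSum.of (fun q : McCool.Idx n => FreeAb (q - 1)) q (Pi.single j 1)) =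
          McCool.cls₁ (McCool.gen q j)) ∧
      (∀ x : McCool.PSigmaPlus n,
        κ (McCool.cls₁ x) = Additive.ofMul (Abelianization.of x))) := by
  refine ⟨fun s hs => ⟨McCool.fiberPartEquiv n ⟨s, by omega⟩⟩,
    ⟨McCool.fiberLie, McCool.fiberEquiv n, McCool.fiberPartEquiv n, McCool.fiberLie_injective,
      McCool.fiberLie_inj, McCool.fiberEquiv_of, ?_, ?_⟩,
    (McCool.sumPartOneEquiv n).trans (McCool.fiberPartEquiv n 1),
    (DescendingCentral.grOneEquiv (McCool.PSigmaPlus n)).toAdditive, ?_, fun _ => rfl⟩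
  · intro s q x
    exact (congrArg _ (McCool.fiberPartSum_of s q x)).trans (McCool.of_fiberPart q s x)
  · intro hn
    -- The pair is `α_{21}`, `α_{32}`: the letters `0` and `1` below stand for `x_1` and `x_2`.
    let p : McCool.Idx n := ⟨2, Finset.mem_Icc.2 (by omega)⟩
    let q : McCool.Idx n := ⟨3, Finset.mem_Icc.2 (by omega)⟩
    have hpq : p < q := Subtype.mk_lt_mk.2 (by norm_num)
    refine ⟨DirectSum.of _ p (FreeLie.inj (Pi.single ⟨0, by norm_num [p]⟩ 1)),
      DirectSum.of _ q (FreeLie.inj (Pi.single ⟨1, by norm_num [q]⟩ 1)), fun h => ?_⟩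
    rw [DirectSum.lie_of_of_ne _ hpq.ne, map_zero, McCool.fiberEquiv_of, McCool.fiberEquiv_of,
      McCool.fiberLie_inj, McCool.fiberLie_inj] at h
    exact McCool.lie_gen_ne_zero hpq _ _ rfl h.symm
  · intro q j
    exact (congrArg (McCool.fiberPartSum n 1) (McCool.sumPartOneEquiv_of q _)).trans
      ((McCool.fiberPartSum_of 1 q _).trans (McCool.fiberPart_toPartOne q j))
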